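/- An election $(C,V)$ consists of a finite set $C$ of candidates and a finite collection $V$ of voters, each given by a preference list (a strict linear order) over $C$. For distinct $a,b\in C$ let $N(a,b)$ be the number of voters who prefer $a$ to $b$. The maximin score of $c\in C$ is $\min_{b\in C\setminus\{c\}}N(c,b)$; the maximin winners are the candidates with the highest score (a sole candidate wins). A candidate is a unique winner if he or she is the one and only winner. In the destructive maximin-AC+DC control problem one is given disjoint finite sets $C$ (candidates) and $A$ (spoiler candidates), a finite collection $V$ of voters with preference lists over $C\cup A$, a despised candidate $d\in C$, and nonnegative integers $k_{\mathrm{AC}}$ and $k_{\mathrm{DC}}$. The question is whether there are sets $A'\subseteq A$ and $C'\subseteq C\setminus\{d\}$ with $|A'|\le k_{\mathrm{AC}}$ and $|C'|\le k_{\mathrm{DC}}$ such that $d$ is not a unique winner of the maximin election $((C\setminus C')\cup A',V)$, where the voters' preference lists are restricted to the candidates taking part. **Theorem.** Maximin is vulnerable to destructive AC+DC control. That is: 1. (Susceptibility) there is an instance of the problem in which $d$ is a unique winner of $(C,V)$ and for which the answer is "yes"; and 2. the destructive maximin-AC+DC control problem is decidable in polynomial time: there is a (multi-stack) Turing machine that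 decides, for every instance, whether the answer is "yes", in a number of steps bounded by a polynomial in the length of the instance's encoding. The encoding lists $d,k_{\mathrm{AC}},k_{\mathrm{DC}}$, the members of $C$, the members of $A$ and all the preference lists, with candidate names (natural numbers) and the two bounds written in binary. -/

import Mathlib

/-! ### Elections

Candidates are named by natural numbers.  A preference list over a set `C` of candidates lists
every member of `C` exactly once, from the most preferred to the least preferred one. -/

/-- An election `(C, V)`: a finite set of candidates and a finite collection of voters, each of
whom is represented by a preference list over the candidates. -/
structure Election where
  candidates : Finset ℕ
  votes : List (List ℕ)
  isPref : ∀ v ∈ votes, v.Nodup ∧ v.toFinset = candidates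

namespace Election

/-- `E.N a b` is the number of voters who prefer `a` to `b` (for distinct candidates `a`, `b`):
those voters on whose list `a` stands before `b`. -/
def N (E : Election) (a b : ℕ) : ℕ :=
  E.votes.countP fun v => decide (v.idxOf a < v.idxOf b)

/-- The election with the candidates of `E` that lie in `S`, every voter ranking them in the
same order as before. -/
def restrict (E : Election) (S : Finset ℕ) : Election where
  candidates := E.candidates ∩ S
  votes := E.votes.map fun v => v.filter fun c => decide (c ∈ S)
  isPref := by
    intro v hv
    obtain ⟨w, hw, rfl⟩ := List.mem_map.mp hv
    obtain ⟨h1, h2⟩ := E.isPref w hw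
    refine ⟨h1.filter _, ?_⟩
    ext c
    rw [← h2]
    simp

end Election

/-- An election system maps every election `(C, V)` to a set of winners `W ⊆ C`. -/
structure ElectionSystem where
  winners : Election → Finset ℕ
  winners_subset : ∀ E, winners E ⊆ E.candidates

/-- `c` is a unique winner of `E`: the one and only winner. -/
def ElectionSystem.UniqueWinner (sys : ElectionSystem) (E : Election) (c : ℕ) : Prop :=
  sys.winners E = {c}

/-- The maximin score of `c` in `E`: the minimum of `N_E(c, b)` over the candidates `b ≠ c`.
(The minimum over the empty set is `⊤`; this concerns only the sole candidate of a
one-candidate election, who wins whatever score is assigned.) -/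
noncomputable def maximinScore (E : Election) (c : ℕ) : ℕ∞ :=
  (E.candidates.erase c).inf fun b => (E.N c b : ℕ∞)

open Classical in
/-- The maximin election system: the winners are the candidates with the highest maximin
score. -/
noncomputable def maximin : ElectionSystem where
  winners E := E.candidates.filter fun c =>
    ∀ b ∈ E.candidates, maximinScore E b ≤ maximinScore E c
  winners_subset _ := Finset.filter_subset _ _

/-! ### Control by adding and deleting candidates -/

/-- An instance of destructive control by adding and deleting candidates. -/
structure ACDCInstance where
  /-- the candidates `C` of the election, listed without repetition -/
  registered : List ℕ
  /-- the spoiler candidates `A`, listed without repetition -/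
  spoilers : List ℕ
  /-- the preference lists of the voters, over `C ∪ A` -/
  votes : List (List ℕ)
  /-- the despised candidate -/
  despised : ℕ
  /-- the bound on the number of candidates to add -/
  kAC : ℕ
  /-- the bound on the number of candidates to delete -/
  kDC : ℕ
  /-- neither list has repetitions, and `C` and `A` are disjoint -/
  nodup : (registered ++ spoilers).Nodup
  votes_perm : ∀ v ∈ votes, v.Perm (registered ++ spoilers)
  despised_mem : despised ∈ registered

namespace ACDCInstance

/-- The set `C` of candidates of the election. -/
def C (I : ACDCInstance) : Finset ℕ := I.registered.toFinset

/-- The set `A` of spoiler candidates. -/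
def A (I : ACDCInstance) : Finset ℕ := I.spoilers.toFinset

/-- The election `(C ∪ A, V)`. -/
def full (I : ACDCInstance) : Election where
  candidates := I.C ∪ I.A
  votes := I.votes
  isPref := by
    intro v hv
    have h := I.votes_perm v hv
    refine ⟨h.nodup_iff.mpr I.nodup, ?_⟩
    ext c
    simp [C, A, h.mem_iff]

/-- The election `(C, V)` before any control action. -/
def original (I : ACDCInstance) : Election := I.full.restrict I.C

/-- The election `((C - C') ∪ A', V)` that results from adding `A'` and deleting `C'`. -/
def controlled (I : ACDCInstance) (A' C' : Finset ℕ) : Election :=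
  I.full.restrict ((I.C \ C') ∪ A')

/-- The question of destructive AC+DC control (separate resources, unique-winner model): can the
despised candidate, who must not be deleted, be prevented from being a unique winner by adding at
most `kAC` candidates from `A` and deleting at most `kDC` candidates from `C`? -/
def IsYes (sys : ElectionSystem) (I : ACDCInstance) : Prop :=
  ∃ A' C' : Finset ℕ, A' ⊆ I.A ∧ C' ⊆ I.C ∧ I.despised ∉ C' ∧
    A'.card ≤ I.kAC ∧ C'.card ≤ I.kDC ∧
    ¬ sys.UniqueWinner (I.controlled A' C') I.despised

end ACDCInstance

/-! ### Encoding of instances as strings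

Numbers are written in binary over Mathlib's Turing machine alphabet `Computability.Γ'`
(blank, bit 0, bit 1, bra, ket, comma). -/

/-- A number in binary, followed by a comma. -/
def encodeNumber (n : ℕ) : List Computability.Γ' :=
  (Computability.encodeNat n).map Computability.Γ'.bit ++ [Computability.Γ'.comma]

/-- A list of numbers, between brackets. -/
def encodeNumberList (l : List ℕ) : List Computability.Γ' :=
  Computability.Γ'.bra :: (l.flatMap encodeNumber ++ [Computability.Γ'.ket])

/-- The input string of an instance: `[d, kAC, kDC]`, then `C`, then `A`, then the votes. -/
def ACDCInstance.encode (I : ACDCInstance) : List Computability.Γ' :=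
  ([I.despised, I.kAC, I.kDC] :: I.registered :: I.spoilers :: I.votes).flatMap encodeNumberList

theorem bits_comma_inj {a b : List Bool} {s t : List Computability.Γ'}
    (h : a.map Computability.Γ'.bit ++ Computability.Γ'.comma :: s =
      b.map Computability.Γ'.bit ++ Computability.Γ'.comma :: t) : a = b ∧ s = t := by
  induction a generalizing b with
  | nil => cases b <;> simp_all
  | cons x a ih =>
    cases b with
    | nil => simp at h
    | cons y b =>
      simp only [List.map_cons, List.cons_append, List.cons.injEq,
        Computability.Γ'.bit.injEq] at h
      obtain ⟨rfl, h⟩ := h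
      obtain ⟨rfl, rfl⟩ := ih h
      exact ⟨rfl, rfl⟩

theorem encodeNumber_append_inj {m n : ℕ} {s t : List Computability.Γ'}
    (h : encodeNumber m ++ s = encodeNumber n ++ t) : m = n ∧ s = t := by
  simp only [encodeNumber, List.append_assoc, List.singleton_append] at h
  obtain ⟨h1, h2⟩ := bits_comma_inj h
  refine ⟨?_, h2⟩
  rw [← Computability.decode_encodeNat m, h1, Computability.decode_encodeNat]

theorem encodeNumber_append_ne_ket {m : ℕ} {s t : List Computability.Γ'} :
    encodeNumber m ++ s ≠ Computability.Γ'.ket :: t := by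
  unfold encodeNumber
  cases Computability.encodeNat m <;> simp

theorem numbers_ket_inj {l m : List ℕ} {s t : List Computability.Γ'}
    (h : l.flatMap encodeNumber ++ Computability.Γ'.ket :: s =
      m.flatMap encodeNumber ++ Computability.Γ'.ket :: t) : l = m ∧ s = t := by
  induction l generalizing m with
  | nil =>
    cases m with
    | nil => simpa using h
    | cons y m =>
      simp only [List.flatMap_nil, List.nil_append, List.flatMap_cons, List.append_assoc] at h
      exact absurd h.symm encodeNumber_append_ne_ket
  | cons x l ih =>
    cases m with
    | nil =>
      simp only [List.flatMap_nil, List.nil_append, List.flatMap_cons, List.append_assoc] at h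
      exact absurd h encodeNumber_append_ne_ket
    | cons y m =>
      simp only [List.flatMap_cons, List.append_assoc] at h
      obtain ⟨rfl, h2⟩ := encodeNumber_append_inj h
      obtain ⟨rfl, rfl⟩ := ih h2
      exact ⟨rfl, rfl⟩

theorem encodeNumberLists_injective :
    Function.Injective fun L : List (List ℕ) => L.flatMap encodeNumberList := by
  intro L
  induction L with
  | nil =>
    intro M h
    cases M with
    | nil => rfl
    | cons y M => simp [encodeNumberList] at h
  | cons x L ih =>
    intro M h
    cases M with
    | nil => simp [encodeNumberList] at h
    | cons y M =>
      simp only [List.flatMap_cons, encodeNumberList, List.cons_append, List.append_assoc,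
        List.nil_append, List.cons.injEq, true_and] at h
      obtain ⟨rfl, h2⟩ := numbers_ket_inj h
      rw [ih h2]

theorem ACDCInstance.encode_injective : Function.Injective ACDCInstance.encode := by
  intro I J h
  have h' := encodeNumberLists_injective h
  obtain ⟨r, s, v, d, a, c, _, _, _⟩ := I
  obtain ⟨r', s', v', d', a', c', _, _, _⟩ := J
  simp only [List.cons.injEq, and_true] at h'
  obtain ⟨⟨rfl, rfl, rfl⟩, rfl, rfl, rfl⟩ := h'
  rfl

open Classical in
/-- Every instance can be recovered from its input string. -/
noncomputable def ACDCInstance.encoding :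
    Computability.Encoding ACDCInstance Computability.Γ' where
  encode := ACDCInstance.encode
  decode s := if h : ∃ I : ACDCInstance, I.encode = s then some h.choose else none
  decode_encode I := by
    have h : ∃ J : ACDCInstance, J.encode = I.encode := ⟨I, rfl⟩
    rw [dif_pos h]
    exact congrArg some (ACDCInstance.encode_injective h.choose_spec)

/-! ### Polynomial time and vulnerability -/

/-- The problem `P` on the instances in `α`, given as strings through the encoding `e`, is decided
by a multi-stack Turing machine (with finitely many stacks, labels, states and input symbols) that
outputs the bit `true` on yes-instances and `false` on no-instances, after a number of steps that
is bounded by a polynomial in the length of the input string. -/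
def DecidableInPolyTime {α Γ : Type} [Fintype Γ] (e : Computability.Encoding α Γ)
    (P : α → Prop) : Prop :=
  ∃ f : α → Bool, (∀ a, f a = true ↔ P a) ∧
    Nonempty (Turing.TM2ComputableInPolyTime e.encode Computability.encodingBoolBool.encode f)

namespace ElectionSystem

/-- There is a scenario in which adding and deleting candidates makes someone stop being a unique
winner. -/
def SusceptibleToDestructiveACDC (sys : ElectionSystem) : Prop :=
  ∃ I : ACDCInstance, sys.UniqueWinner I.original I.despised ∧ I.IsYes sys

/-- Susceptibility, together with a polynomial-time algorithm for the control problem. -/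
def VulnerableToDestructiveACDC (sys : ElectionSystem) : Prop :=
  sys.SusceptibleToDestructiveACDC ∧
    DecidableInPolyTime ACDCInstance.encoding (ACDCInstance.IsYes sys)

end ElectionSystem

/-! The despised candidate `d` fails to be the unique winner exactly when some other participant `c`
scores at least as much as `d`. The score of `d` is attained against some participant `b`, so this
says that N(c,e) ≥ N(d,b) for all participants e ≠ c. Here b = c is allowed, and none of these
numbers depends on who else takes part (`not_uniqueWinner_maximin_iff`, `Election.restrict_N`).

Fix the pair (c,b). The cheapest control action is then forced: add those of c and b that are
spoilers, since further spoilers only bring further constraints, and delete exactly the registered e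
≠ c with N(c,e) < N(d,b). It succeeds if and only if N(c,d) ≥ N(d,b), N(c,b) ≥ N(d,b) in case c ≠ b,
and both budgets suffice. The answer is therefore found by trying quadratically many pairs
(`ACDCInstance.isYes_maximin_iff`).

The search has to run on a Turing machine. Programs in the language `Cmd` have a semantics with step
bounds, `Cmd.Runs`, which `Cmd.Runs.iterate_step` transfers to Mathlib's `TM2` machines;
`Cmd.decidableInPolyTime` turns a correct program into a decision procedure. Strings are cut into
items, so that a program can be specified by its effect on a record of lists of items (`ACDC.Mem`,
`ACDC.Exec`). Vote counts are kept in unary, as they are bounded by the input length. The two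
budgets arrive in binary and may be exponentially large, so they are never expanded, but decremented
once for each candidate to be added or deleted. All bounds are expressed through the input length
(`ACDC.exec_check`, `ACDC.exec_solve`), and `ACDC.any_input` identifies the computed bit with the
answer. -/

/-! ### A structured language for multi-stack machines -/

/-- Programs acting on stacks of symbols from `Γ`, indexed by `K`, and on a register in `S`. -/
inductive Cmd (K S Γ : Type) : Type
  | pop (k : K) (f : S → Option Γ → S)
  | push (k : K) (g : S → Γ)
  | load (f : S → S)
  | seq (a b : Cmd K S Γ)
  | ite (k : K) (p : S → Option Γ → Bool) (a b : Cmd K S Γ)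
  | loop (k : K) (p : S → Option Γ → Bool) (a : Cmd K S Γ)

namespace Cmd

variable {K S Γ : Type}

/-- `Runs c s s' t`: started in `s`, the program `c` ends in `s'` after at most `t` steps. -/
inductive Runs [DecidableEq K] :
    Cmd K S Γ → S × (K → List Γ) → S × (K → List Γ) → ℕ → Prop
  | pop (k f x σ) :
      Runs (.pop k f) (x, σ) (f x (σ k).head?, Function.update σ k (σ k).tail) 1
  | push (k g x σ) : Runs (.push k g) (x, σ) (x, Function.update σ k (g x :: σ k)) 1
  | load (f x σ) : Runs (.load f) (x, σ) (f x, σ) 1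
  | seq {a b s s₁ s₂ t₁ t₂} : Runs a s s₁ t₁ → Runs b s₁ s₂ t₂ → Runs (.seq a b) s s₂ (t₁ + t₂)
  | ite_true {k p a b x σ s' t} : p x (σ k).head? = true → Runs a (x, σ) s' t →
      Runs (.ite k p a b) (x, σ) s' (t + 1)
  | ite_false {k p a b x σ s' t} : p x (σ k).head? = false → Runs b (x, σ) s' t →
      Runs (.ite k p a b) (x, σ) s' (t + 1)
  | loop_false {k p a x σ} : p x (σ k).head? = false → Runs (.loop k p a) (x, σ) (x, σ) 1
  | loop_true {k p a x σ s₁ s₂ t₁ t₂} : p x (σ k).head? = true → Runs a (x, σ) s₁ t₁ →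
      Runs (.loop k p a) s₁ s₂ t₂ → Runs (.loop k p a) (x, σ) s₂ (t₁ + t₂ + 1)
  | mono {c s s' t t'} : Runs c s s' t → t ≤ t' → Runs c s s' t'

/-- The labels of the machine that executes a program. -/
def Lab : Cmd K S Γ → Type
  | pop _ _ | push _ _ | load _ => Unit
  | seq a b => Lab a ⊕ Lab b
  | ite _ _ a b => Option (Lab a ⊕ Lab b)
  | loop _ _ a => Option (Lab a)

/-- There are finitely many labels. -/
@[reducible] def fintypeLab : (c : Cmd K S Γ) → Fintype (Lab c)
  | pop _ _ | push _ _ | load _ => inferInstanceAs (Fintype Unit)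
  | seq a b =>
    letI := fintypeLab a
    letI := fintypeLab b
    inferInstanceAs (Fintype (Lab a ⊕ Lab b))
  | ite _ _ a b =>
    letI := fintypeLab a
    letI := fintypeLab b
    inferInstanceAs (Fintype (Option (Lab a ⊕ Lab b)))
  | loop _ _ a =>
    letI := fintypeLab a
    inferInstanceAs (Fintype (Option (Lab a)))

/-- The label at which the execution of a program starts. -/
def entry : (c : Cmd K S Γ) → Lab c
  | pop _ _ | push _ _ | load _ => ()
  | seq a _ => .inl (entry a)
  | ite _ _ _ _ | loop _ _ _ => none

/-- The symbols on the stacks of the machine: there is one additional stack for the output. -/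
def Sym (K Γ : Type) : Option K → Type
  | none => Bool
  | some _ => Γ

open Turing in
/-- The statements of the machine, for labels embedded by `ι` and a label `exit` to continue at. -/
def code {Λ : Type} : (c : Cmd K S Γ) → (Lab c → Λ) → Λ → Lab c →
    TM2.Stmt (Sym K Γ) Λ (S × Bool)
  | pop k f, _, exit, _ =>
    .pop (some k) (fun v x => (f v.1 x, v.2)) (.goto fun _ => exit)
  | push k g, _, exit, _ => .push (some k) (fun v => g v.1) (.goto fun _ => exit)
  | load f, _, exit, _ => .load (fun v => (f v.1, v.2)) (.goto fun _ => exit)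
  | seq a b, ι, _, .inl l => code a (fun l => ι (.inl l)) (ι (.inr (entry b))) l
  | seq _ b, ι, exit, .inr l => code b (fun l => ι (.inr l)) exit l
  | ite k p a b, ι, _, none =>
    .peek (some k) (fun v x => (v.1, p v.1 x))
      (.branch (fun v => v.2)
        (.load (fun v => (v.1, false)) (.goto fun _ => ι (some (.inl (entry a)))))
        (.load (fun v => (v.1, false)) (.goto fun _ => ι (some (.inr (entry b))))))
  | ite _ _ a _, ι, exit, some (.inl l) => code a (fun l => ι (some (.inl l))) exit l
  | ite _ _ _ b, ι, exit, some (.inr l) => code b (fun l => ι (some (.inr l))) exit l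
  | loop k p a, ι, exit, none =>
    .peek (some k) (fun v x => (v.1, p v.1 x))
      (.branch (fun v => v.2)
        (.load (fun v => (v.1, false)) (.goto fun _ => ι (some (entry a))))
        (.load (fun v => (v.1, false)) (.goto fun _ => exit)))
  | loop _ _ a, ι, _, some l => code a (fun l => ι (some l)) (ι none) l

/-- The stacks of the machine, with an empty output stack. -/
def stk (σ : K → List Γ) : (k : Option K) → List (Sym K Γ k)
  | none => []
  | some k => σ k

theorem update_stk [DecidableEq K] (σ : K → List Γ) (k : K) (l : List Γ) :
    Function.update (stk σ) (some k) l = stk (Function.update σ k l) := by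
  funext k'
  cases k' with
  | none => exact Function.update_of_ne (by simp) _ _
  | some k' =>
    by_cases h : k' = k
    · subst h
      exact (Function.update_self _ _ _).trans (Function.update_self k' l σ).symm
    · have h' : Function.update σ k l k' = σ k' := by simp [h]
      refine Eq.trans ?_ h'.symm
      exact Function.update_of_ne (by simpa using h) _ _

open Turing in
/-- The configuration of the machine at the label `l` in the state `s`. -/
def cfg {Λ : Type} (l : Λ) (s : S × (K → List Γ)) : TM2.Cfg (Sym K Γ) Λ (S × Bool) :=
  ⟨some l, (s.1, false), stk s.2⟩

-- A `TM2` machine branches on its register only, so the outcome of a test on a stack symbol passes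
-- through the additional Boolean; resetting it afterwards brings the machine back to the form
-- `cfg`.
open Turing in
theorem step_branch [DecidableEq K] {Λ : Type} {m : Λ → TM2.Stmt (Sym K Γ) Λ (S × Bool)}
    {l l₁ l₂ : Λ} {k : K}
    {p : S → Option Γ → Bool}
    (hm : m l = .peek (some k) (fun v x => (v.1, p v.1 x))
      (.branch (fun v => v.2) (.load (fun v => (v.1, false)) (.goto fun _ => l₁))
        (.load (fun v => (v.1, false)) (.goto fun _ => l₂)))) (x : S) (σ : K → List Γ) :
    TM2.step m (cfg l (x, σ)) = some (cfg (if p x (σ k).head? then l₁ else l₂) (x, σ)) := by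
  simp only [TM2.step, cfg, hm, TM2.stepAux]
  change some (bif p x (σ k).head? then _ else _) = _
  cases p x (σ k).head? <;> rfl

-- Induction on the run, for all embeddings `ι` of the labels and all exits at once, because a
-- subprogram is entered with a different continuation: the second half of a sequence, or the head
-- of the surrounding loop.
open Turing in
theorem Runs.iterate_step [DecidableEq K] {Λ : Type} (m : Λ → TM2.Stmt (Sym K Γ) Λ (S × Bool))
    {c : Cmd K S Γ} {s s' : S × (K → List Γ)} {t : ℕ} (h : Runs c s s' t) :
    ∀ (ι : Lab c → Λ) (exit : Λ), (∀ l, m (ι l) = code c ι exit l) →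
      ∃ t' ≤ t, (flip bind (TM2.step m))^[t'] (some (cfg (ι (entry c)) s)) =
        some (cfg exit s') := by
  induction h with
  | pop k f x σ =>
    intro ι exit hm
    refine ⟨1, le_rfl, ?_⟩
    simp [flip, cfg, TM2.step, hm, code, TM2.stepAux, ← update_stk]
    exact ⟨rfl, rfl⟩
  | push k g x σ =>
    intro ι exit hm
    refine ⟨1, le_rfl, ?_⟩
    simp [flip, cfg, TM2.step, hm, code, TM2.stepAux]
    exact update_stk σ k _
  | load f x σ =>
    intro ι exit hm
    exact ⟨1, le_rfl, by simp [flip, cfg, TM2.step, hm, code, TM2.stepAux]⟩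
  | @seq a b _ _ _ _ _ _ _ iha ihb =>
    intro ι exit hm
    obtain ⟨t₁, h₁, e₁⟩ := iha (fun l => ι (.inl l)) (ι (.inr (entry b)))
      (fun l => hm (.inl l))
    obtain ⟨t₂, h₂, e₂⟩ := ihb (fun l => ι (.inr l)) exit (fun l => hm (.inr l))
    refine ⟨t₂ + t₁, by omega, ?_⟩
    rw [Function.iterate_add_apply]
    exact (congrArg _ e₁).trans e₂
  | @ite_true k p a b x σ _ _ hp _ ih =>
    intro ι exit hm
    obtain ⟨t₁, h₁, e₁⟩ := ih (fun l => ι (some (.inl l))) exit (fun l => hm (some (.inl l)))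
    refine ⟨t₁ + 1, by omega, ?_⟩
    rw [Function.iterate_succ_apply, ← e₁]
    have := step_branch (hm (none : Option (Lab a ⊕ Lab b))) x σ
    rw [if_pos hp] at this
    exact congrArg _ this
  | @ite_false k p a b x σ _ _ hp _ ih =>
    intro ι exit hm
    obtain ⟨t₁, h₁, e₁⟩ := ih (fun l => ι (some (.inr l))) exit (fun l => hm (some (.inr l)))
    refine ⟨t₁ + 1, by omega, ?_⟩
    rw [Function.iterate_succ_apply, ← e₁]
    have := step_branch (hm (none : Option (Lab a ⊕ Lab b))) x σ
    rw [if_neg (by simp [hp])] at this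
    exact congrArg _ this
  | @loop_false k p a x σ hp =>
    intro ι exit hm
    refine ⟨1, le_rfl, ?_⟩
    have := step_branch (hm (none : Option (Lab a))) x σ
    rw [if_neg (by simp [hp])] at this
    exact this
  | @loop_true k p a x σ _ _ _ _ hp _ _ iha ihb =>
    intro ι exit hm
    obtain ⟨t₁, h₁, e₁⟩ := iha (fun l => ι (some l)) (ι (none : Option (Lab a)))
      (fun l => hm (some l))
    obtain ⟨t₂, h₂, e₂⟩ := ihb ι exit hm
    refine ⟨t₂ + (t₁ + 1), by omega, ?_⟩
    rw [Function.iterate_add_apply, Function.iterate_succ_apply, ← e₂]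
    have := step_branch (hm (none : Option (Lab a))) x σ
    rw [if_pos hp] at this
    exact congrArg _ ((congrArg _ this).trans e₁)
  | mono _ hle ih =>
    intro ι exit hm
    obtain ⟨t₁, h₁, e₁⟩ := ih ι exit hm
    exact ⟨t₁, h₁.trans hle, e₁⟩

open Turing in
/-- The machine that executes `c` on the input stack `k₀` from the register `x₀`, and then
outputs a bit. -/
def machine [DecidableEq K] [Fintype K] [Fintype S] [Fintype Γ] (c : Cmd K S Γ) (k₀ : K) (x₀ : S)
    (ans : S → Bool) : FinTM2 where
  K := Option K
  k₀ := some k₀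
  k₁ := none
  Γ := Sym K Γ
  Λ := Option (Lab c)
  main := some (entry c)
  ΛFin := letI := fintypeLab c; inferInstance
  σ := S × Bool
  initialState := (x₀, false)
  Γk₀Fin := inferInstanceAs (Fintype Γ)
  m
    | some l => code c some none l
    | none => .push none (fun v => ans v.1) (.load (fun _ => (x₀, false)) .halt)

open Turing in
/-- A program that empties its stacks within polynomial time and leaves the answer in its register
yields a decision procedure in polynomial time. -/
theorem decidableInPolyTime [DecidableEq K] [Fintype K] [Fintype S] [Fintype Γ] {α : Type}
    (e : Computability.Encoding α Γ) (P : α → Prop) (c : Cmd K S Γ) (k₀ : K) (x₀ : S)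
    (ans : S → Bool) (time : Polynomial ℕ)
    (h : ∀ a, ∃ x, Runs c (x₀, Function.update (fun _ => []) k₀ (e.encode a)) (x, fun _ => [])
      (time.eval (e.encode a).length) ∧ (ans x = true ↔ P a)) :
    DecidableInPolyTime e P := by
  choose x hx hans using h
  refine ⟨fun a => ans (x a), hans, ⟨⟨⟨machine c k₀ x₀ ans, Equiv.refl Γ, Equiv.refl Bool⟩,
    time + 1, fun a => ?_⟩⟩⟩
  have := (hx a).iterate_step (machine c k₀ x₀ ans).m some none (fun _ => rfl)
  choose t ht e using this
  -- The program takes `t` steps to reach the label `none`; one more step outputs the bit and halts.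
  refine ⟨⟨t + 1, ?_⟩, by simpa using ht⟩
  rw [add_comm, Function.iterate_add_apply]
  refine Eq.trans (congrArg _ ((congrArg _ ?_).trans e)) ?_
  · simp only [cfg, initList, Equiv.refl_symm, Equiv.invFun_as_coe]
    congr 2
    funext k
    cases k with
    | none => rfl
    | some k =>
      by_cases hk : k = k₀
      · subst hk
        simp [stk, machine]
        exact List.map_id _
      · simp [stk, hk, machine]
        rfl
  -- A halting configuration in Mathlib's sense has the initial register and nothing on the stacks
  -- but the output. Hence the last instruction resets the register, and the program must empty its
  -- stacks.
  · change some (⟨none, (x₀, false), Function.update (stk fun _ => []) none _⟩ :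
      TM2.Cfg (Sym K Γ) (Option (Lab c)) (S × Bool)) = some ⟨none, (x₀, false), _⟩
    congr 2
    funext k
    cases k with
    | none => simp [stk]; rfl
    | some k => rfl

end Cmd

open Computability (Γ')

/-! ### Items -/

/-- The symbol that ends an item. -/
inductive Mark
  | bra
  | ket
  | comma
  deriving DecidableEq

/-- The symbol of a mark. -/
def Mark.sym : Mark → Γ'
  | bra => .bra
  | ket => .ket
  | comma => .comma

/-- Input strings consist of items: a string of bits, followed by a mark. -/
abbrev Item : Type := List Bool × Mark

/-- The string of an item. -/
def Item.str (x : Item) : List Γ' := x.1.map Γ'.bit ++ [x.2.sym]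

theorem Item.length_str (x : Item) : x.str.length = x.1.length + 1 := by simp [str]

/-- The item without bits that serves as unit of the unary counters. -/
def unitItem : Item := ([], .bra)

/-- Whether the symbol on top of a stack is a bit. -/
def isBit : Option Γ' → Bool
  | some (.bit _) => true
  | _ => false

@[simp] theorem isBit_sym (m : Mark) : isBit (some m.sym) = false := by cases m <;> rfl

theorem Mark.sym_ne_bit (m : Mark) (b : Bool) : m.sym ≠ .bit b := by cases m <;> simp [sym]

theorem Mark.sym_injective : Function.Injective Mark.sym := by
  intro a b h
  cases a <;> cases b <;> simp_all [sym]

/-! ### The memory of the machine -/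

namespace ACDC

/-- The variables of the program, each of which holds a stack of items. -/
inductive Var
  | votes | votes' | desp | kac | kdc | cand | cand' | wit | wit' | reg | reg' | spoil | spoil'
  | cnt | cnt' | work | bud
  deriving DecidableEq

instance : Fintype Var where
  elems := {.votes, .votes', .desp, .kac, .kdc, .cand, .cand', .wit, .wit', .reg, .reg', .spoil,
    .spoil', .cnt, .cnt', .work, .bud}
  complete x := by cases x <;> decide

/-- The register of the machine. -/
structure Reg where
  a : Option Γ'
  b : Option Γ'
  r : Bool
  v : Option Bool
  bad : Bool
  ans : Bool
  deriving Fintype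

/-- The contents of the memory between two operations on items. -/
structure Mem where
  v : Option Bool
  bad : Bool
  ans : Bool
  votes : List Item
  votes' : List Item
  desp : List Item
  kac : List Item
  kdc : List Item
  cand : List Item
  cand' : List Item
  wit : List Item
  wit' : List Item
  reg : List Item
  reg' : List Item
  spoil : List Item
  spoil' : List Item
  cnt : List Item
  cnt' : List Item
  work : List Item
  bud : List Item

/-- The value of a variable. -/
def Mem.get (m : Mem) : Var → List Item
  | .votes => m.votes
  | .votes' => m.votes'
  | .desp => m.desp
  | .kac => m.kac
  | .kdc => m.kdc
  | .cand => m.cand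
  | .cand' => m.cand'
  | .wit => m.wit
  | .wit' => m.wit'
  | .reg => m.reg
  | .reg' => m.reg'
  | .spoil => m.spoil
  | .spoil' => m.spoil'
  | .cnt => m.cnt
  | .cnt' => m.cnt'
  | .work => m.work
  | .bud => m.bud

/-- Assigning a value to a variable. -/
def Mem.set (m : Mem) (i : Var) (l : List Item) : Mem :=
  match i with
  | .votes => { m with votes := l }
  | .votes' => { m with votes' := l }
  | .desp => { m with desp := l }
  | .kac => { m with kac := l }
  | .kdc => { m with kdc := l }
  | .cand => { m with cand := l }
  | .cand' => { m with cand' := l }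
  | .wit => { m with wit := l }
  | .wit' => { m with wit' := l }
  | .reg => { m with reg := l }
  | .reg' => { m with reg' := l }
  | .spoil => { m with spoil := l }
  | .spoil' => { m with spoil' := l }
  | .cnt => { m with cnt := l }
  | .cnt' => { m with cnt' := l }
  | .work => { m with work := l }
  | .bud => { m with bud := l }

theorem Mem.get_set (m : Mem) (i j : Var) (l : List Item) :
    (m.set i l).get j = if j = i then l else m.get j := by
  cases i <;> cases j <;> rfl

@[simp] theorem Mem.get_set_self (m : Mem) (i : Var) (l : List Item) : (m.set i l).get i = l := by
  simp [get_set]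

@[simp] theorem Mem.get_set_of_ne (m : Mem) {i j : Var} (h : j ≠ i) (l : List Item) :
    (m.set i l).get j = m.get j := by
  simp [get_set, h]

@[simp] theorem Mem.set_set (m : Mem) (i : Var) (l l' : List Item) :
    (m.set i l).set i l' = m.set i l' := by
  cases i <;> rfl

theorem Mem.set_comm (m : Mem) {i j : Var} (h : i ≠ j) (l l' : List Item) :
    (m.set i l).set j l' = (m.set j l').set i l := by
  cases i <;> cases j <;> first | rfl | exact absurd rfl h

@[simp] theorem Mem.set_get (m : Mem) (i : Var) : m.set i (m.get i) = m := by
  cases i <;> rfl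

/-- The registers. -/
def Mem.register (m : Mem) : Reg := ⟨none, none, false, m.v, m.bad, m.ans⟩

@[simp] theorem Mem.register_set (m : Mem) (i : Var) (l : List Item) :
    (m.set i l).register = m.register := by
  cases i <;> rfl

/-- The stacks, one of which is a scratch stack. -/
def Mem.stack (m : Mem) : Option Var → List Γ'
  | none => []
  | some i => (m.get i).flatMap Item.str

theorem Mem.stack_set (m : Mem) (i : Var) (l : List Item) :
    (m.set i l).stack = Function.update m.stack (some i) (l.flatMap Item.str) := by
  funext k
  cases k with
  | none => simp [stack]
  | some j =>
    by_cases h : j = i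
    · subst h; simp [stack]
    · simp [stack, h]

/-- The state of the machine. -/
def Mem.enc (m : Mem) : Reg × (Option Var → List Γ') := (m.register, m.stack)

/-- The programs used here. -/
abbrev Prog : Type := Cmd (Option Var) Reg Γ'

/-- The program `c` transforms `m` into `m'` within `t` steps. -/
def Exec (c : Prog) (m m' : Mem) (t : ℕ) : Prop := c.Runs m.enc m'.enc t

open Cmd

theorem runs_of_eq {c : Prog} {s s' s'' : Reg × (Option Var → List Γ')} {t t' : ℕ}
    (h : c.Runs s s' t) (hs : s' = s'') (ht : t ≤ t') : c.Runs s s'' t' :=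
  hs ▸ h.mono ht

theorem runs_congr {c : Prog} {s s' s'' : Reg × (Option Var → List Γ')} {t : ℕ}
    (hs : s = s') (h : c.Runs s' s'' t) : c.Runs s s'' t :=
  hs ▸ h

theorem Exec.seq {c c' : Prog} {m m' m'' : Mem} {t t' : ℕ} (h : Exec c m m' t)
    (h' : Exec c' m' m'' t') : Exec (.seq c c') m m'' (t + t') :=
  Runs.seq h h'

theorem Exec.mono {c : Prog} {m m' : Mem} {t t' : ℕ} (h : Exec c m m' t) (ht : t ≤ t') :
    Exec c m m' t' :=
  Runs.mono h ht

/-! ### Basic operations on items -/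

/-- Pop a symbol into the register `a`. -/
def popA (i : Option Var) : Prog := .pop i fun x s => { x with a := s }

/-- Push the symbol in the register `a`. -/
def pushA (i : Option Var) : Prog := .push i fun x => x.a.getD .blank

/-- Reset the symbol registers. -/
def resetAB : Prog := .load fun x => { x with a := none, b := none }

/-- Move the bits on top of a variable to the scratch stack. -/
def spill (i : Var) : Prog :=
  .loop (some i) (fun _ s => isBit s) (.seq (popA (some i)) (.seq (pushA none) resetAB))

/-- Move the scratch stack to a variable. -/
def unspill (i : Var) : Prog :=
  .loop none (fun _ s => s.isSome) (.seq (popA none) (.seq (pushA (some i)) resetAB))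

/-- Move the scratch stack to two variables. -/
def unspillTwo (i j : Var) : Prog :=
  .loop none (fun _ s => s.isSome)
    (.seq (popA none) (.seq (pushA (some i)) (.seq (pushA (some j)) resetAB)))

/-- Push a copy of the top item of `i` on `j`. -/
def dup (i j : Var) : Prog :=
  .seq (spill i) (.seq (popA (some i)) (.seq (pushA (some i)) (.seq (pushA (some j))
    (.seq resetAB (unspillTwo i j)))))

/-- Delete the top item. -/
def drop (i : Var) : Prog :=
  .seq (.loop (some i) (fun _ s => isBit s) (.pop (some i) fun x _ => x))
    (.pop (some i) fun x _ => x)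

/-- Move the top item of `i` to `j`. -/
def mv (i j : Var) : Prog := .seq (dup i j) (drop i)

section

variable {σ : Option Var → List Γ'} {x : Reg}

/-- The bits arrive on the scratch stack in reverse order; `unspill` and `unspillTwo` reverse them
once more. The hypothesis `hx` says that the symbol registers are clear, as each round leaves them.
-/
theorem runs_spill {i : Var} {l : List Bool} {s : Γ'} {w : List Γ'} (hs : isBit (some s) = false)
    (hx : x = { x with a := none, b := none }) (h : σ (some i) = l.map Γ'.bit ++ s :: w) :
    (spill i).Runs (x, σ)
      (x, Function.update (Function.update σ (some i) (s :: w)) none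
        ((l.map Γ'.bit).reverse ++ σ none)) (4 * l.length + 1) := by
  induction l generalizing σ with
  | nil =>
    refine runs_of_eq (.loop_false (by simpa [h] using hs)) ?_ (by simp)
    congr 1
    funext k
    rcases k with _ | k
    · simp
    · by_cases hk : k = i
      · subst hk; simpa using h
      · simp [hk]
  | cons b l ih =>
    refine runs_of_eq (.loop_true (by simp [h, isBit])
      (runs_of_eq (s'' := (x, Function.update (Function.update σ (some i)
        (l.map Γ'.bit ++ s :: w)) none (.bit b :: σ none)))
        (.seq (.pop ..) (.seq (.push ..) (.load ..))) ?_ le_rfl) (ih (by simp))) ?_ ?_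
    · rw [hx]; simp [h]
    · congr 1
      funext k
      rcases k with _ | k
      · simp
      · by_cases hk : k = i
        · subst hk; simp
        · simp [hk]
    · simp; omega

theorem runs_unspill {i : Var} {l : List Γ'}
    (hx : x = { x with a := none, b := none }) (h : σ none = l) :
    (unspill i).Runs (x, σ)
      (x, Function.update (Function.update σ none []) (some i) (l.reverse ++ σ (some i)))
      (4 * l.length + 1) := by
  induction l generalizing σ with
  | nil =>
    have h' : Function.update σ none [] = σ := by rw [← h]; simp
    exact runs_of_eq (.loop_false (by simp [h])) (by simp [h']) (by simp)
  | cons b l ih =>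
    refine runs_of_eq (.loop_true (by simp [h])
      (runs_of_eq (s'' := (x, Function.update (Function.update σ none l) (some i)
        (b :: σ (some i))))
        (.seq (.pop ..) (.seq (.push ..) (.load ..))) ?_ le_rfl) (ih (by simp))) ?_ ?_
    · rw [hx]; simp [h]
    · congr 1
      funext k
      rcases k with _ | k
      · simp
      · by_cases hk : k = i
        · subst hk; simp
        · simp [hk]
    · simp; omega

theorem runs_unspillTwo {i j : Var} (hij : i ≠ j) {l : List Γ'}
    (hx : x = { x with a := none, b := none }) (h : σ none = l) :
    (unspillTwo i j).Runs (x, σ)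
      (x, Function.update (Function.update (Function.update σ none [])
        (some i) (l.reverse ++ σ (some i))) (some j) (l.reverse ++ σ (some j)))
      (5 * l.length + 1) := by
  induction l generalizing σ with
  | nil =>
    have h' : Function.update σ none [] = σ := by rw [← h]; simp
    exact runs_of_eq (.loop_false (by simp [h])) (by simp [h']) (by simp)
  | cons b l ih =>
    refine runs_of_eq (.loop_true (by simp [h])
      (runs_of_eq (s'' := (x, Function.update (Function.update (Function.update σ none l) (some i)
        (b :: σ (some i))) (some j) (b :: σ (some j))))
        (.seq (.pop ..) (.seq (.push ..) (.seq (.push ..) (.load ..)))) ?_ le_rfl)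
        (ih (by simp))) ?_ ?_
    · rw [hx]; simp [h, hij.symm]
    · congr 1
      funext k
      rcases k with _ | k
      · simp
      · by_cases hk : k = i
        · subst hk; simp [hij]
        · by_cases hk' : k = j
          · subst hk'; simp
          · simp [hk, hk']
    · simp; omega

end

theorem Mem.register_eq (m : Mem) : m.register = { m.register with a := none, b := none } := rfl

/-- The mark lies below the bits, so it is put back on both stacks before the bits return from the
scratch stack. The cost is stated through a common bound `N` on item lengths so that costs inside
loops are uniform. -/
theorem exec_dup {m : Mem} {i j : Var} (hij : i ≠ j) {x : Item} {w : List Item} {N : ℕ}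
    (h : m.get i = x :: w) (hN : x.1.length ≤ N) :
    Exec (dup i j) m (m.set j (x :: m.get j)) (20 * (N + 1)) := by
  have hs : m.stack (some i) = x.1.map Γ'.bit ++ x.2.sym :: w.flatMap Item.str := by
    simp [Mem.stack, h, Item.str]
  refine runs_of_eq (.seq (runs_spill (isBit_sym _) m.register_eq hs) (.seq (.pop ..)
    (.seq (.push ..) (.seq (.push ..) (.seq (.load ..)
      (runs_unspillTwo hij (l := (x.1.map Γ'.bit).reverse) rfl ?_)))))) ?_ ?_
  · simp [Mem.stack]
  · refine Prod.ext (by simp only [Mem.enc, Mem.register_set]; rfl) ?_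
    funext k
    simp only [Mem.enc, Mem.stack_set]
    rcases k with _ | k
    · simp [Mem.stack]
    · by_cases hk : k = j
      · subst hk; simp [hij.symm, Mem.stack, Item.str]
      · by_cases hk' : k = i
        · subst hk'; simp [hij, Mem.stack, Item.str, h]
        · simp [hk, hk', Mem.stack]
  · simp; omega

theorem runs_skipBits {σ : Option Var → List Γ'} {x : Reg} {i : Var} {l : List Bool} {s : Γ'}
    {w : List Γ'} (hs : isBit (some s) = false) (h : σ (some i) = l.map Γ'.bit ++ s :: w) :
    Cmd.Runs (.loop (some i) (fun _ s => isBit s) (.pop (some i) fun x _ => x)) (x, σ)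
      (x, Function.update σ (some i) (s :: w)) (2 * l.length + 1) := by
  induction l generalizing σ with
  | nil =>
    refine runs_of_eq (.loop_false (by simpa [h] using hs)) ?_ (by simp)
    simp at h
    simp [← h]
  | cons b l ih =>
    refine runs_of_eq (.loop_true (by simp [h, isBit]) (.pop ..) (ih (by simp [h]))) ?_ ?_
    · simp
    · simp; omega

theorem exec_drop {m : Mem} {i : Var} {x : Item} {w : List Item} {N : ℕ}
    (h : m.get i = x :: w) (hN : x.1.length ≤ N) :
    Exec (drop i) m (m.set i w) (20 * (N + 1)) := by
  have hs : m.stack (some i) = x.1.map Γ'.bit ++ x.2.sym :: w.flatMap Item.str := by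
    simp [Mem.stack, h, Item.str]
  refine runs_of_eq (.seq (runs_skipBits (isBit_sym _) hs) (.pop ..)) ?_ ?_
  · simp [Mem.enc, Mem.stack_set]
  · omega

theorem exec_mv {m : Mem} {i j : Var} (hij : i ≠ j) {x : Item} {w : List Item} {N : ℕ}
    (h : m.get i = x :: w) (hN : x.1.length ≤ N) :
    Exec (mv i j) m ((m.set j (x :: m.get j)).set i w) (40 * (N + 1)) :=
  (Exec.seq (exec_dup hij h hN) (exec_drop (by simpa [hij] using h) hN)).mono (by omega)

/-! ### Branching, flags and unary counters -/

/-- Do nothing. -/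
def skip : Prog := .load id

theorem exec_skip (m : Mem) : Exec skip m m 1 := Cmd.Runs.load ..

/-- Branch according to the register. -/
def test (p : Reg → Bool) (a b : Prog) : Prog := .ite none (fun x _ => p x) a b

theorem exec_test {p : Reg → Bool} {a b : Prog} {m m' : Mem} {t : ℕ}
    (h : Exec (if p m.register then a else b) m m' t) : Exec (test p a b) m m' (t + 1) := by
  by_cases hp : p m.register
  · rw [if_pos hp] at h
    exact .ite_true hp h
  · rw [if_neg hp] at h
    exact .ite_false (by simpa using hp) h

/-- Branch according to whether a variable is the empty list. -/
def ifEmpty (i : Var) (a b : Prog) : Prog := .ite (some i) (fun _ s => s.isNone) a b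

/-- Every item contributes at least its mark, so emptiness of the list is visible on the stack. -/
theorem Mem.isSome_head?_stack (m : Mem) (i : Var) :
    (m.stack (some i)).head?.isSome = !(m.get i).isEmpty := by
  rcases h : m.get i with _ | ⟨x, w⟩
  · simp [Mem.stack, h]
  · rcases x with ⟨_ | ⟨_, _⟩, _⟩ <;> simp [Mem.stack, h, Item.str]

theorem exec_ifEmpty {i : Var} {a b : Prog} {m m' : Mem} {t : ℕ}
    (h : Exec (if m.get i = [] then a else b) m m' t) : Exec (ifEmpty i a b) m m' (t + 1) := by
  have := m.isSome_head?_stack i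
  split_ifs at h with hi
  · exact .ite_true (by simpa [hi] using this) h
  · exact .ite_false (by rw [← Option.not_isSome, this]; simpa using hi) h

/-- Branch according to whether the top item of a variable is a closing bracket. -/
def ifKet (i : Var) (a b : Prog) : Prog := .ite (some i) (fun _ s => decide (s = some .ket)) a b

theorem Mem.head?_stack_eq_ket {m : Mem} {i : Var} {x : Item} {w : List Item}
    (h : m.get i = x :: w) : (m.stack (some i)).head? = some Γ'.ket ↔ x = ([], .ket) := by
  rcases x with ⟨_ | ⟨b, l⟩, k⟩
  · cases k <;> simp [Mem.stack, h, Item.str, Mark.sym]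
  · simp [Mem.stack, h, Item.str]

theorem exec_ifKet {i : Var} {a b : Prog} {m m' : Mem} {t : ℕ} {x : Item} {w : List Item}
    (hi : m.get i = x :: w)
    (h : Exec (if x = ([], .ket) then a else b) m m' t) : Exec (ifKet i a b) m m' (t + 1) := by
  have := Mem.head?_stack_eq_ket hi
  split_ifs at h with hx
  · exact .ite_true (by simpa [hx] using this) h
  · exact .ite_false (by simpa [hx] using this) h

/-- Change the flags in the register. -/
def flags (f : Option Bool → Bool → Bool → Option Bool × Bool × Bool) : Prog :=
  .load fun x => { x with
    v := (f x.v x.bad x.ans).1, bad := (f x.v x.bad x.ans).2.1, ans := (f x.v x.bad x.ans).2.2 }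

theorem exec_flags (m : Mem) (f : Option Bool → Bool → Bool → Option Bool × Bool × Bool) :
    Exec (flags f) m { m with
      v := (f m.v m.bad m.ans).1
      bad := (f m.v m.bad m.ans).2.1
      ans := (f m.v m.bad m.ans).2.2 } 1 := by
  refine runs_of_eq (.load ..) (Prod.ext rfl ?_) le_rfl
  funext k
  rcases k with _ | k
  · rfl
  · cases k <;> rfl

/-- Push a unit. -/
def pushUnit (i : Var) : Prog := .push (some i) fun _ => .bra

theorem exec_pushUnit (m : Mem) (i : Var) :
    Exec (pushUnit i) m (m.set i (unitItem :: m.get i)) 1 := by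
  refine runs_of_eq (.push ..) ?_ le_rfl
  simp [Mem.enc, Mem.stack_set, Mem.stack, unitItem, Item.str, Mark.sym]

/-- Pop a unit. -/
def popUnit (i : Var) : Prog := .pop (some i) fun x _ => x

/-- A unit is a single symbol, and popping an empty stack does nothing; this is truncated
subtraction. -/
theorem exec_popUnit {m : Mem} {i : Var} {n : ℕ} (h : m.get i = List.replicate n unitItem) :
    Exec (popUnit i) m (m.set i (List.replicate (n - 1) unitItem)) 1 := by
  refine runs_of_eq (.pop ..) ?_ le_rfl
  cases n <;> simp [Mem.enc, Mem.stack_set, Mem.stack, unitItem, Item.str, Mark.sym, h,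
    List.replicate_succ]

/-- Empty a variable. -/
def clear (i : Var) : Prog := .loop (some i) (fun _ s => s.isSome) (.pop (some i) fun x _ => x)

theorem runs_clear {σ : Option Var → List Γ'} {x : Reg} {i : Var} {l : List Γ'}
    (h : σ (some i) = l) :
    (clear i).Runs (x, σ) (x, Function.update σ (some i) []) (2 * l.length + 1) := by
  induction l generalizing σ with
  | nil => exact runs_of_eq (.loop_false (by simp [h])) (by simp [← h]) (by simp)
  | cons b l ih =>
    refine runs_of_eq (.loop_true (by simp [h]) (.pop ..) (ih (by simp [h]))) ?_ ?_
    · simp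
    · simp; omega

theorem exec_clear (m : Mem) (i : Var) :
    Exec (clear i) m (m.set i []) (2 * ((m.get i).flatMap Item.str).length + 1) := by
  refine runs_of_eq (runs_clear rfl) ?_ ?_
  · simp [Mem.enc, Mem.stack_set]
  · simp [Mem.stack]


/-! ### Equality test for items -/

/-- Compare the top items of `i` and `j`, up to the first difference. -/
def compareLoop (i j : Var) : Prog :=
  .loop none (fun x _ => x.r) (.seq (popA (some i)) (.seq (.pop (some j) fun x s => { x with b := s })
    (.ite none (fun x _ => isBit x.a && decide (x.a = x.b)) (.seq (pushA none) resetAB)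
      (.load fun x => { x with r := false }))))

/-- Branch according to whether the top items of `i` and `j` are equal. -/
def ifEq (i j : Var) (a b : Prog) : Prog :=
  .seq (.load fun x => { x with r := true }) (.seq (compareLoop i j)
    (.seq (pushA (some i)) (.seq (.push (some j) fun x => x.b.getD .blank)
      (.seq (.load fun x => { x with a := none, b := none, r := decide (x.a = x.b) })
        (.seq (unspillTwo i j)
          (test (fun x => x.r) (.seq (.load fun x => { x with r := false }) a) b))))))

/-- The word `p` is a common prefix of the two stacks, and `a`, `b` are the symbols at which the
comparison stops: the first place where the symbols differ or where a mark is met. Since a mark ends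
its item, equality of `a` and `b` decides equality of the items. -/
theorem runs_compareLoop {i j : Var} (hij : i ≠ j) {σ : Option Var → List Γ'} {x : Reg}
    (hx : x = { x with a := none, b := none, r := true }) {l l' : List Bool} {s s' : Γ'}
    {w w' : List Γ'} (hs : isBit (some s) = false) (hs' : isBit (some s') = false)
    (hi : σ (some i) = l.map Γ'.bit ++ s :: w) (hj : σ (some j) = l'.map Γ'.bit ++ s' :: w') :
    ∃ p a b u u', σ (some i) = p ++ a :: u ∧ σ (some j) = p ++ b :: u' ∧
      (a = b ↔ l = l' ∧ s = s') ∧ p.length ≤ l.length ∧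
      (compareLoop i j).Runs (x, σ) ({ x with a := some a, b := some b, r := false },
        Function.update (Function.update (Function.update σ (some i) u) (some j) u') none
          (p.reverse ++ σ none)) (6 * l.length + 6) := by
  have hr : x.r = true := by rw [hx]
  -- The last round: both symbols stay in the registers and the flag `r` is lowered, which ends the
  -- loop.
  have mismatch : ∀ (σ : Option Var → List Γ') a b u u', σ (some i) = a :: u →
      σ (some j) = b :: u' → (isBit (some a) = false ∨ a ≠ b) →
      (compareLoop i j).Runs (x, σ) ({ x with a := some a, b := some b, r := false },
        Function.update (Function.update (Function.update σ (some i) u) (some j) u') none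
          (σ none)) 6 := by
    intro σ a b u u' hi hj hab
    refine runs_of_eq (.loop_true hr (.seq (.pop ..) (.seq (.pop ..)
      (.ite_false ?_ (.load ..)))) (.loop_false rfl)) ?_ le_rfl
    · simp only [hi, hij.symm, hj, ne_eq, Option.some.injEq, not_false_eq_true,
        Function.update_of_ne, List.head?_cons]
      rcases hab with hab | hab <;> simp [hab]
    · have : Function.update (Function.update (Function.update σ (some i) u) (some j) u') none
          (σ none) = Function.update (Function.update σ (some i) u) (some j) u' := by
        rw [Function.update_eq_self_iff]
        simp
      rw [this]
      simp [hi, hj, hij.symm]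
  induction l generalizing σ l' with
  | nil =>
    cases l' with
    | nil =>
      exact ⟨[], s, s', w, w', hi, hj, by simp, le_rfl, mismatch _ _ _ _ _ hi hj (.inl hs)⟩
    | cons b l' =>
      have : s ≠ .bit b := by rintro rfl; simp [isBit] at hs
      exact ⟨[], s, .bit b, w, _, hi, hj, by simp [this], le_rfl, mismatch _ _ _ _ _ hi hj (.inl hs)⟩
  | cons c l ih =>
    cases l' with
    | nil =>
      have : Γ'.bit c ≠ s' := by rintro rfl; simp [isBit] at hs'
      exact ⟨[], .bit c, s', _, _, hi, hj, by simp [this], by simp,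
        (mismatch _ _ _ _ _ hi hj (.inr this)).mono (by omega)⟩
    | cons b l' =>
      by_cases hcb : c = b
      · subst hcb
        obtain ⟨p, a, b, u, u', h1, h2, h3, h4, h5⟩ := ih
          (σ := Function.update (Function.update (Function.update σ (some i)
            (l.map Γ'.bit ++ s :: w)) (some j) (l'.map Γ'.bit ++ s' :: w')) none
              (.bit c :: σ none)) (l' := l') (by simp [hij]) (by simp)
        · simp only [ne_eq, reduceCtorEq, not_false_eq_true, Function.update_of_ne,
            Option.some.injEq, hij, Function.update_self] at h1 h2
          refine ⟨.bit c :: p, a, b, u, u', by simpa [hi] using h1, by simpa [hj] using h2,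
            by simpa using h3, by simpa using h4, ?_⟩
          refine runs_of_eq (.loop_true hr (runs_of_eq
            (.seq (.pop ..) (.seq (.pop ..) (.ite_true ?_ (.seq (.push ..) (.load ..)))))
              ?_ le_rfl) h5) ?_ ?_
          · simp [hi, hj, hij.symm, isBit]
          · rw [hx]; simp [hi, hj, hij.symm]
          · congr 1
            funext k
            rcases k with _ | k
            · simp
            · by_cases hk : k = i
              · subst hk; simp [hij]
              · by_cases hk' : k = j
                · subst hk'; simp
                · simp [hk, hk']
          · simp; omega
      · exact ⟨[], .bit c, .bit b, _, _, hi, hj, by simp [hcb], by simp,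
          (mismatch _ _ _ _ _ hi hj (.inr (by simpa using hcb))).mono (by omega)⟩

/-- The bits that have been read agree on both stacks, so the single copy on the scratch stack is
enough to restore both, after the two deciding symbols have been pushed back. -/
theorem exec_ifEq {i j : Var} (hij : i ≠ j) {a b : Prog} {m m' : Mem} {x y : Item}
    {w w' : List Item} {t N : ℕ} (hi : m.get i = x :: w) (hj : m.get j = y :: w')
    (hN : x.1.length ≤ N) (h : Exec (if x = y then a else b) m m' t) :
    Exec (ifEq i j a b) m m' (20 * (N + 1) + t) := by
  have hsi : m.stack (some i) = x.1.map Γ'.bit ++ x.2.sym :: w.flatMap Item.str := by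
    simp [Mem.stack, hi, Item.str]
  have hsj : m.stack (some j) = y.1.map Γ'.bit ++ y.2.sym :: w'.flatMap Item.str := by
    simp [Mem.stack, hj, Item.str]
  obtain ⟨p, c, c', u, u', h1, h2, h3, h4, h5⟩ := runs_compareLoop hij (σ := m.stack)
    (x := { m.register with r := true }) rfl (isBit_sym _) (isBit_sym _) hsi hsj
  have hxy : c = c' ↔ x = y := by
    rw [h3, Prod.ext_iff, Mark.sym_injective.eq_iff]
  have htest : Cmd.Runs (test (fun x => x.r) (.seq (.load fun x => { x with r := false }) a) b)
      ({ m.register with r := decide (x = y) }, m.stack) m'.enc (t + 2) := by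
    split_ifs at h with hxy
    · refine runs_of_eq (.ite_true (by simpa using hxy) (.seq (.load ..) h)) rfl (by omega)
    · have : ({ m.register with r := decide (x = y) }, m.stack) = m.enc := by simp [hxy]; rfl
      rw [this]
      exact runs_of_eq (.ite_false (by rfl) h) rfl (by omega)
  refine runs_of_eq (.seq (.load ..) (.seq h5 (.seq (.push ..) (.seq (.push ..)
    (.seq (.load ..) (.seq (runs_unspillTwo hij (l := p.reverse) rfl ?_)
      (runs_congr ?_ htest))))))) rfl ?_
  · simp [Mem.stack]
  · refine Prod.ext (by simp [hxy, Mem.register]) ?_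
    funext k
    rcases k with _ | k
    · simp [Mem.stack]
    · by_cases hk : k = j
      · subst hk; simp [h2, hij.symm]
      · by_cases hk' : k = i
        · subst hk'; simp [hij, h1]
        · simp [hk, hk']
  · simp; omega

/-! ### Decrementing a number in binary -/

/-- Subtract one from a number in binary. -/
def decBits : List Bool → List Bool
  | [] => []
  | true :: l => false :: l
  | false :: l => true :: decBits l

theorem decBits_replicate_append (k : ℕ) (l : List Bool) :
    decBits (List.replicate k false ++ l) = List.replicate k true ++ decBits l := by
  induction k with
  | zero => rfl
  | succ k ih => simp [List.replicate_succ, decBits, ih]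

theorem length_decBits (l : List Bool) : (decBits l).length = l.length := by
  induction l with
  | nil => rfl
  | cons b l ih => cases b <;> simp [decBits, ih]

/-- Turn the leading zeros of a number into ones on the scratch stack. -/
def borrow (i : Var) : Prog :=
  .loop (some i) (fun _ s => decide (s = some (.bit false)))
    (.seq (.pop (some i) fun x _ => x) (.push none fun _ => .bit true))

/-- Subtract one from the number on top of `i`, and continue with `a` if that number is zero. -/
def decOr (i : Var) (a : Prog) : Prog :=
  .seq (borrow i) (.seq
    (.ite (some i) (fun _ s => decide (s = some (.bit true)))
      (.seq (.pop (some i) fun x _ => x) (.push (some i) fun _ => .bit false))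
      (.load fun x => { x with r := true }))
    (.seq (unspill i) (test (fun x => x.r) (.seq (.load fun x => { x with r := false }) a) skip)))

theorem runs_borrow {σ : Option Var → List Γ'} {x : Reg} {i : Var} {k : ℕ}
    {w : List Γ'} (hw : w.head? ≠ some (.bit false))
    (h : σ (some i) = List.replicate k (.bit false) ++ w) :
    (borrow i).Runs (x, σ) (x, Function.update (Function.update σ (some i) w) none
      (List.replicate k (.bit true) ++ σ none)) (3 * k + 1) := by
  induction k generalizing σ with
  | zero =>
    simp only [List.replicate_zero, List.nil_append] at h
    refine runs_of_eq (.loop_false (by simpa [h] using hw)) ?_ (by simp)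
    simp [← h]
  | succ k ih =>
    refine runs_of_eq (.loop_true (by simp [h, List.replicate_succ]) (.seq (.pop ..) (.push ..))
      (ih (by simp [h, List.replicate_succ]))) ?_ (by omega)
    congr 1
    funext j
    rcases j with _ | j
    · simp [List.replicate_succ']
    · by_cases hj : j = i
      · subst hj; simp
      · simp [hj]

theorem exists_eq_replicate_append (l : List Bool) :
    ∃ k l', l = List.replicate k false ++ l' ∧ (l' = [] ∨ ∃ u, l' = true :: u) := by
  induction l with
  | nil => exact ⟨0, [], rfl, .inl rfl⟩
  | cons b l ih =>
    cases b with
    | true => exact ⟨0, _, rfl, .inr ⟨l, rfl⟩⟩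
    | false =>
      obtain ⟨k, l', rfl, h⟩ := ih
      exact ⟨k + 1, l', rfl, h⟩

/-- Borrowing turns the leading (least significant) zeros into ones up to the first one. If there is
none, the number was zero; it underflows to a string of ones, and `a` is executed in that state. -/
theorem exec_decOr {i : Var} {a : Prog} {m m' : Mem} {l : List Bool} {k : Mark}
    {w : List Item} {t N : ℕ} (hi : m.get i = (l, k) :: w) (hN : l.length ≤ N)
    (h : Exec (if true ∈ l then skip else a) (m.set i ((decBits l, k) :: w)) m' t) :
    Exec (decOr i a) m m' (20 * (N + 1) + t) := by
  obtain ⟨n, l', rfl, hl'⟩ := exists_eq_replicate_append l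
  have hs : m.stack (some i) = List.replicate n (.bit false) ++
      (l'.map Γ'.bit ++ k.sym :: w.flatMap Item.str) := by
    simp [Mem.stack, hi, Item.str]
  have hstack : Function.update (Function.update (Function.update (Function.update m.stack (some i)
      ((decBits l').map Γ'.bit ++ k.sym :: w.flatMap Item.str)) none
        (List.replicate n (.bit true))) none []) (some i) (List.replicate n (.bit true) ++
          ((decBits l').map Γ'.bit ++ k.sym :: w.flatMap Item.str)) =
      (m.set i ((decBits (List.replicate n false ++ l'), k) :: w)).stack := by
    rw [Mem.stack_set]
    funext j
    rcases j with _ | j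
    · simp [Mem.stack]
    · by_cases hj : j = i
      · subst hj; simp [Item.str, decBits_replicate_append]
      · simp [hj]
  simp only [List.length_append, List.length_replicate] at hN
  rcases hl' with rfl | ⟨u, rfl⟩
  · rw [if_neg (by simp)] at h
    refine runs_of_eq (.seq (runs_borrow (by simpa using k.sym_ne_bit false) hs)
      (.seq (.ite_false (by simpa using k.sym_ne_bit true) (.load ..))
        (.seq (runs_unspill (l := List.replicate n (.bit true)) rfl (by simp [Mem.stack]))
          (.ite_true rfl (.seq (.load ..) (runs_congr ?_ h)))))) rfl ?_
    · refine Prod.ext (by simp only [Mem.enc, Mem.register_set]; rfl) ?_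
      rw [Mem.enc, ← hstack]
      funext j
      rcases j with _ | j
      · simp
      · by_cases hj : j = i
        · subst hj; simp [decBits]
        · simp [hj]
    · simp at hN ⊢; omega
  · rw [if_pos (by simp)] at h
    refine runs_of_eq (.seq (runs_borrow (by simp) hs)
      (.seq (.ite_true (by simp) (.seq (.pop ..) (.push ..)))
        (.seq (runs_unspill (l := List.replicate n (.bit true)) rfl (by simp [Mem.stack]))
          (.ite_false rfl (runs_congr ?_ h))))) rfl ?_
    · refine Prod.ext (by simp only [Mem.enc, Mem.register_set]) ?_
      rw [Mem.enc, ← hstack]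
      funext j
      rcases j with _ | j
      · simp
      · by_cases hj : j = i
        · subst hj; simp [decBits]
        · simp [hj]
    · simp at hN ⊢; omega

/-! ### Loops -/

/-- Repeat `a` as long as the variable `i` is nonempty. -/
def whileNonempty (i : Var) (a : Prog) : Prog := .loop (some i) (fun _ s => s.isSome) a

theorem exec_whileNonempty_nil {i : Var} {a : Prog} {m : Mem} (h : m.get i = []) :
    Exec (whileNonempty i a) m m 1 :=
  .loop_false (by simpa [h] using m.isSome_head?_stack i)

theorem exec_whileNonempty_cons {i : Var} {a : Prog} {m m' m'' : Mem} {t t' : ℕ}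
    (h : m.get i ≠ []) (h₁ : Exec a m m' t) (h₂ : Exec (whileNonempty i a) m' m'' t') :
    Exec (whileNonempty i a) m m'' (t + t' + 1) :=
  .loop_true ((m.isSome_head?_stack i).trans (by simpa using h)) h₁ h₂

/-- Move all items of `i` to `j`. -/
def mvAll (i j : Var) : Prog := whileNonempty i (mv i j)

theorem exec_mvAll {i j : Var} (hij : i ≠ j) {m : Mem} {l : List Item} {N : ℕ}
    (h : m.get i = l) (hN : ∀ x ∈ l, x.1.length ≤ N) :
    Exec (mvAll i j) m ((m.set j (l.reverse ++ m.get j)).set i [])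
      (l.length * (40 * (N + 1) + 1) + 1) := by
  induction l generalizing m with
  | nil =>
    have e : (m.set j (([] : List Item).reverse ++ m.get j)).set i [] = m := by
      rw [← h]
      simp [h]
      rw [← h]
      simp
    rw [e]
    exact (exec_whileNonempty_nil h).mono (by omega)
  | cons x l ih =>
    have := exec_whileNonempty_cons (by simp [h]) (exec_mv hij h (hN x (by simp)))
      (ih (by simp) fun y hy => hN y (by simp [hy]))
    rw [Mem.get_set_of_ne _ hij.symm, Mem.get_set_self, Mem.set_comm _ hij, Mem.set_set,
      Mem.set_set] at this
    simp only [List.reverse_cons, List.append_assoc, List.singleton_append]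
    exact this.mono (by simp only [List.length_cons, add_mul]; omega)

/-- Execute `a` for every item of `i`, which is on top of `i` then. The items before it are in
`j`, in reverse order. -/
def forEach (i j : Var) (a : Prog) : Prog :=
  .seq (whileNonempty i (.seq a (mv i j))) (mvAll j i)

/-- A loop rule with invariant: `S p` is the memory after the prefix `p` has been processed. The
values of `S p` at `i` and `j` are irrelevant, as they are overwritten by the position of the
traversal. -/
theorem exec_forEach {i j : Var} (hij : i ≠ j) {a : Prog} (S : List Item → Mem) {l : List Item}
    {T N : ℕ} (hN : ∀ x ∈ l, x.1.length ≤ N)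
    (h : ∀ p x q, l = p ++ x :: q → Exec a (((S p).set i (x :: q)).set j p.reverse)
      (((S (p ++ [x])).set i (x :: q)).set j p.reverse) T) :
    Exec (forEach i j a) (((S []).set i l).set j []) (((S l).set i l).set j [])
      (l.length * (T + 80 * (N + 1) + 2) + 2) := by
  have loop : ∀ q p, l = p ++ q → Exec (whileNonempty i (.seq a (mv i j)))
      (((S p).set i q).set j p.reverse) (((S l).set i []).set j l.reverse)
      (q.length * (T + 40 * (N + 1) + 1) + 1) := by
    intro q
    induction q with
    | nil =>
      rintro p rfl
      rw [List.append_nil]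
      exact (exec_whileNonempty_nil (by simp [hij])).mono (by omega)
    | cons x q ih =>
      intro p hp
      have h₁ := (h p x q hp).seq (exec_mv hij (w := q) (N := N) (by simp [hij]) (hN x (by simp [hp])))
      have h₂ := ih (p ++ [x]) (by simp [hp])
      rw [Mem.get_set_self, Mem.set_set, Mem.set_comm _ hij.symm, Mem.set_set] at h₁
      rw [List.reverse_concat] at h₂
      have h₃ : (((S p).set i (x :: q)).set j p.reverse).get i ≠ [] := by simp [hij]
      refine (exec_whileNonempty_cons h₃ h₁ h₂).mono ?_
      simp only [List.length_cons, add_mul]; omega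
  -- The traversal leaves the items on `j` in reverse order; moving them back restores `i`. The two
  -- moves of every item account for the term `80 * (N + 1)`.
  have h₂ := (loop l [] rfl).seq (exec_mvAll hij.symm (l := l.reverse) (N := N) (by simp) (by simpa using hN))
  simp only [List.reverse_nil, List.reverse_reverse, hij, ne_eq, not_false_eq_true,
    Mem.get_set_of_ne, Mem.get_set_self, List.append_nil] at h₂
  rw [Mem.set_comm _ hij.symm, Mem.set_set, Mem.set_set] at h₂
  exact h₂.mono (by rw [List.length_reverse]; exact le_of_eq (by ring))

end ACDC

/-! ### Numbers in binary -/

/-- The value of a number in binary, least significant bit first. -/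
def bitsVal : List Bool → ℕ
  | [] => 0
  | b :: l => b.toNat + 2 * bitsVal l

namespace ACDC

theorem bitsVal_pos_iff (l : List Bool) : 0 < bitsVal l ↔ true ∈ l := by
  induction l with
  | nil => simp [bitsVal]
  | cons b l ih => cases b <;> simp [bitsVal, ← ih]

theorem bitsVal_decBits {l : List Bool} (h : 0 < bitsVal l) :
    bitsVal (decBits l) = bitsVal l - 1 := by
  induction l with
  | nil => simp [bitsVal] at h
  | cons b l ih =>
    cases b with
    | true => simp [bitsVal, decBits]
    | false =>
      simp only [bitsVal, Bool.toNat_false, zero_add, Nat.ofNat_pos, mul_pos_iff_of_pos_left]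
        at h
      simp only [decBits, bitsVal, Bool.toNat_true, Bool.toNat_false, zero_add, ih h]
      omega

theorem bitsVal_iterate_decBits {l : List Bool} {k : ℕ} (h : k ≤ bitsVal l) :
    bitsVal (decBits^[k] l) = bitsVal l - k := by
  induction k with
  | zero => rfl
  | succ k ih =>
    rw [Function.iterate_succ_apply', bitsVal_decBits (by rw [ih (by omega)]; omega),
      ih (by omega)]
    omega

theorem length_iterate_decBits (l : List Bool) (k : ℕ) :
    (decBits^[k] l).length = l.length := by
  induction k with
  | zero => rfl
  | succ k ih => rw [Function.iterate_succ_apply', length_decBits, ih]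

theorem true_mem_iterate_decBits {l : List Bool} {k : ℕ} (h : k ≤ bitsVal l) :
    true ∈ decBits^[k] l ↔ k < bitsVal l := by
  rw [← bitsVal_pos_iff, bitsVal_iterate_decBits h]
  omega

/-! ### Counting the voters who prefer one candidate to another -/

/-- The item that ends a list. -/
abbrev ketItem : Item := ([], .ket)

/-- One step of the traversal of the votes: the state tells which of `x` and `y` was found first
in the current vote, and counts the votes in which it was `x`. -/
def scanStep (x y : Item) (s : Option Bool × ℕ) (z : Item) : Option Bool × ℕ :=
  if z = ketItem then (none, if s.1 = some true then s.2 + 1 else s.2)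
  else if s.1 = none then
    (if z = y then some false else if z = x then some true else none, s.2)
  else s

/-- The traversal of the votes. -/
def scanAll (x y : Item) (l : List Item) : Option Bool × ℕ := l.foldl (scanStep x y) (none, 0)

theorem scanAll_concat (x y z : Item) (l : List Item) :
    scanAll x y (l ++ [z]) = scanStep x y (scanAll x y l) z := by
  simp [scanAll]

theorem snd_foldl_scanStep_le (x y : Item) (l : List Item) (s : Option Bool × ℕ) :
    (l.foldl (scanStep x y) s).2 ≤ s.2 + l.length := by
  induction l generalizing s with
  | nil => simp
  | cons z l ih =>
    refine (ih _).trans ?_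
    have : (scanStep x y s z).2 ≤ s.2 + 1 := by
      unfold scanStep
      split_ifs <;> simp
    simp only [List.length_cons]
    omega

theorem snd_scanAll_le (x y : Item) (l : List Item) : (scanAll x y l).2 ≤ l.length := by
  simpa [scanAll] using snd_foldl_scanStep_le x y l (none, 0)

/-! ### The traversal of the votes as a program -/

/-- Changing the flag `v`. -/
def Mem.setV (m : Mem) (v : Option Bool) : Mem := { m with v := v }

@[simp] theorem Mem.get_setV (m : Mem) (v : Option Bool) (i : Var) :
    (m.setV v).get i = m.get i := by
  cases i <;> rfl

theorem Mem.setV_set (m : Mem) (v : Option Bool) (i : Var) (l : List Item) :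
    (m.setV v).set i l = (m.set i l).setV v := by
  cases i <;> rfl

@[simp] theorem Mem.v_setV (m : Mem) (v : Option Bool) : (m.setV v).v = v := rfl

@[simp] theorem Mem.v_set (m : Mem) (i : Var) (l : List Item) : (m.set i l).v = m.v := by
  cases i <;> rfl

/-- Set the flag `v`. -/
def assignV (v : Option Bool) : Prog := flags fun _ bad ans => (v, bad, ans)

theorem exec_assignV (m : Mem) (v : Option Bool) : Exec (assignV v) m (m.setV v) 1 :=
  exec_flags m _

/-- Branch according to the flag `v`. -/
def ifV (v : Option Bool) (a b : Prog) : Prog := test (fun x => decide (x.v = v)) a b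

theorem exec_ifV {v : Option Bool} {a b : Prog} {m m' : Mem} {t : ℕ}
    (h : Exec (if m.v = v then a else b) m m' t) : Exec (ifV v a b) m m' (t + 1) := by
  refine exec_test ?_
  by_cases hv : m.v = v
  · rw [if_pos hv] at h
    have e : decide (m.register.v = v) = true := decide_eq_true hv
    rwa [e, if_pos rfl]
  · rw [if_neg hv] at h
    have e : decide (m.register.v = v) = false := decide_eq_false hv
    rwa [e, if_neg Bool.false_ne_true]

/-- Execute `act` for each voter who prefers the top item of `i` to the top item of `j`. -/
def scan (i j : Var) (act : Prog) : Prog :=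
  forEach .votes .votes'
    (ifKet .votes (.seq (ifV (some true) act skip) (assignV none))
      (ifV none
        (ifEq .votes j (assignV (some false)) (ifEq .votes i (assignV (some true)) skip)) skip))

/-- The variable `k` is a unary counter and `f` the effect of `act` on it; one proof thus covers
counting up (`pushUnit`) and counting down (`popUnit`). -/
theorem exec_scan {i j k : Var} (hik : i ≠ k) (hjk : j ≠ k) (hi : i ≠ .votes) (hi' : i ≠ .votes')
    (hj : j ≠ .votes) (hj' : j ≠ .votes') (hk : k ≠ .votes) (hk' : k ≠ .votes') {act : Prog}
    {f : ℕ → ℕ} (hact : ∀ (m : Mem) n, m.get k = List.replicate n unitItem →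
      Exec act m (m.set k (List.replicate (f n) unitItem)) 1)
    {m : Mem} {x y : Item} {w w' l : List Item} {n N : ℕ} (hx : m.get i = x :: w)
    (hy : m.get j = y :: w') (hl : m.get .votes = l) (hl' : m.get .votes' = []) (hv : m.v = none)
    (hn : m.get k = List.replicate n unitItem) (hv' : (scanAll x y l).1 = none)
    (hN : ∀ z ∈ l, z.1.length ≤ N) (hlN : l.length ≤ N) :
    Exec (scan i j act) m (m.set k (List.replicate (f^[(scanAll x y l).2] n) unitItem))
      (N * (120 * (N + 1) + 7) + 2) := by
  have hm (v : Mem) (hv : v.get .votes = l) (hv' : v.get .votes' = []) :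
      (v.set .votes l).set .votes' [] = v := by
    rw [← hv, Mem.set_get, ← hv', Mem.set_get]
  -- Invariant: after the prefix `p`, the flag `v` is the first component of `scanAll x y p`, and
  -- `f` has been applied to the counter as often as the second component says.
  have key := exec_forEach (i := .votes) (j := .votes') (by decide)
    (a := (ifKet .votes (.seq (ifV (some true) act skip) (assignV none))
      (ifV none
        (ifEq .votes j (assignV (some false)) (ifEq .votes i (assignV (some true)) skip)) skip)))
    (fun p => (m.set k (List.replicate (f^[(scanAll x y p).2] n) unitItem)).setV
      (scanAll x y p).1) (l := l) (T := 40 * (N + 1) + 5) hN ?_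
  · have e0 : (m.set k (List.replicate (f^[(scanAll x y []).2] n) unitItem)).setV
        (scanAll x y []).1 = m := by
      have : scanAll x y [] = (none, 0) := rfl
      rw [this, Function.iterate_zero_apply, ← hn, Mem.set_get, ← hv]
      rfl
    have e1 : ∀ u, (m.set k u).setV none = m.set k u := by
      intro u
      have : none = (m.set k u).v := by rw [Mem.v_set, hv]
      rw [this]
      rfl
    simp only [e0, hv', e1] at key
    rw [hm _ hl hl', hm] at key
    · refine key.mono ?_
      refine Nat.add_le_add_right (Nat.mul_le_mul hlN ?_) 2
      omega
    · rw [Mem.get_set_of_ne _ hk.symm, hl]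
    · rw [Mem.get_set_of_ne _ hk'.symm, hl']
  · rintro p z q rfl
    rw [scanAll_concat]
    obtain ⟨v, c⟩ := scanAll x y p
    have hz : z.1.length ≤ N := hN z (by simp)
    refine Exec.mono (exec_ifKet (x := z) (w := q) (t := 40 * (N + 1) + 4) (by simp) ?_) le_rfl
    split_ifs with hzk
    · simp only [scanStep, if_pos hzk]
      have step : Exec (ifV (some true) act skip)
          ((((m.set k (List.replicate (f^[c] n) unitItem)).setV v).set .votes (z :: q)).set .votes'
            p.reverse)
          ((((m.set k (List.replicate (f^[if v = some true then c + 1 else c] n) unitItem)).setV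
            v).set .votes (z :: q)).set .votes' p.reverse) 2 := by
        refine exec_ifV (t := 1) ?_
        rw [Mem.v_set, Mem.v_set, Mem.v_setV]
        split_ifs with hvt
        · convert hact _ (f^[c] n) ?_ using 1
          · rw [Mem.set_comm _ hk'.symm, Mem.set_comm _ hk.symm, Function.iterate_succ_apply']
            simp only [Mem.setV_set, Mem.set_set]
          · simp [hk, hk']
        · exact exec_skip _
      have h := step.seq (exec_assignV _ none)
      simp only [Mem.setV_set] at h ⊢
      refine h.mono ?_
      omega
    · simp only [scanStep, if_neg hzk]
      refine exec_ifV (t := 40 * (N + 1) + 3) ?_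
      rw [Mem.v_set, Mem.v_set, Mem.v_setV]
      by_cases hvn : v = none
      · subst hvn
        rw [if_pos rfl, if_pos rfl]
        have hv (v') := exec_assignV ((((m.set k (List.replicate (f^[c] n) unitItem)).setV none).set
            .votes (z :: q)).set .votes' p.reverse) v'
        simp only [Mem.setV_set] at hv
        refine Exec.mono (exec_ifEq hj.symm (x := z) (y := y) (w := q) (w' := w') (N := N)
          (t := 20 * (N + 1) + 1) (by simp) (by simp [hj, hj', hjk, hy]) hz ?_) (by omega)
        by_cases hzy : z = y
        · rw [if_pos hzy, if_pos hzy]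
          simp only [Mem.setV_set]
          refine (hv _).mono ?_
          omega
        · rw [if_neg hzy, if_neg hzy]
          refine Exec.mono (exec_ifEq hi.symm (x := z) (y := x) (w := q) (w' := w) (N := N)
            (t := 1) (by simp) (by simp [hi, hi', hik, hx]) hz ?_) (by omega)
          by_cases hzx : z = x
          · rw [if_pos hzx, if_pos hzx]
            simp only [Mem.setV_set]
            exact hv _
          · rw [if_neg hzx, if_neg hzx]
            exact exec_skip _
      · rw [if_neg hvn, if_neg hvn]
        refine (exec_skip _).mono ?_
        omega

/-! ### Comparing a vote count with a unary counter -/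

/-- Execute `a` if fewer voters prefer the top item of `i` to the top item of `j` than the unary
counter says. -/
def ifFewer (i j : Var) (a : Prog) : Prog :=
  .seq (forEach .cnt .cnt' (pushUnit .work)) (.seq (scan i j (popUnit .work))
    (ifEmpty .work skip (.seq (clear .work) a)))

/-- A copy of the counter loses one unit for every voter counted. By truncated subtraction,
something is left exactly when the count is smaller than `n`. -/
theorem exec_ifFewer {i j : Var} (hiw : i ≠ .work) (hjw : j ≠ .work) (hi : i ≠ .votes)
    (hi' : i ≠ .votes') (hj : j ≠ .votes) (hj' : j ≠ .votes') {a : Prog}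
    {m m' : Mem} {x y : Item} {w w' l : List Item} {n N t : ℕ} (hx : m.get i = x :: w)
    (hy : m.get j = y :: w') (hl : m.get .votes = l) (hl' : m.get .votes' = []) (hv : m.v = none)
    (hn : m.get .cnt = List.replicate n unitItem) (hn' : m.get .cnt' = [])
    (hw : m.get .work = []) (hv' : (scanAll x y l).1 = none)
    (hN : ∀ z ∈ l, z.1.length ≤ N) (hlN : l.length ≤ N) (hnN : n ≤ N)
    (h : Exec (if (scanAll x y l).2 < n then a else skip) m m' t) :
    Exec (ifFewer i j a) m m'
      (N * (1 + 80 * (N + 1) + 2) + N * (120 * (N + 1) + 7) + 2 * N + 6 + t) := by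
  have h₁ : Exec (forEach .cnt .cnt' (pushUnit .work)) m
      (m.set .work (List.replicate n unitItem)) (N * (1 + 80 * (N + 1) + 2) + 2) := by
    have key := exec_forEach (i := .cnt) (j := .cnt') (by decide) (a := pushUnit .work)
      (fun p => m.set .work (List.replicate p.length unitItem))
      (l := List.replicate n unitItem) (T := 1) (N := N)
      (by simp [unitItem]) ?_
    · have e1 : (((m.set .work (List.replicate ([] : List Item).length unitItem)).set .cnt
          (List.replicate n unitItem)).set .cnt' []) = m := by
        rw [List.length_nil, List.replicate_zero]
        nth_rw 1 [← hw]
        rw [← hn, ← hn']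
        rfl
      have e2 : (((m.set .work (List.replicate n unitItem)).set .cnt
          (List.replicate n unitItem)).set .cnt' []) =
          m.set .work (List.replicate n unitItem) := by
        nth_rw 2 [← hn]
        rw [← hn']
        rfl
      rw [e1] at key
      simp only [List.length_replicate, e2] at key
      exact key.mono (Nat.add_le_add_right (Nat.mul_le_mul_right _ hnN) 2)
    · intro p z q _
      refine runs_of_eq (exec_pushUnit _ _) ?_ le_rfl
      rw [List.length_append, List.length_singleton, List.replicate_succ]
      rfl
  have h₂ := exec_scan (k := .work) hiw hjw hi hi' hj hj' (by decide) (by decide)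
    (fun _ _ => exec_popUnit) (m := m.set .work (List.replicate n unitItem)) (n := n)
    (by rw [Mem.get_set_of_ne _ hiw, hx]) (by rw [Mem.get_set_of_ne _ hjw, hy]) hl hl' hv
    (by simp) hv' hN hlN
  have hsub : ∀ k, (fun n => n - 1)^[k] n = n - k := by
    intro k
    induction k with
    | zero => rfl
    | succ k ih => rw [Function.iterate_succ_apply', ih]; omega
  rw [hsub, Mem.set_set] at h₂
  have hm : m.set .work [] = m := by rw [← hw]; rfl
  have h₃ : Exec (ifEmpty .work skip (.seq (clear .work) a))
      (m.set .work (List.replicate (n - (scanAll x y l).2) unitItem)) m'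
      (2 * N + 1 + t + 1) := by
    refine exec_ifEmpty (t := 2 * N + 1 + t) ?_
    split_ifs at h with hlt
    · rw [if_neg (by simp; omega)]
      have hc := exec_clear (m.set .work (List.replicate (n - (scanAll x y l).2) unitItem)) .work
      rw [Mem.set_set, hm] at hc
      refine (hc.seq h).mono ?_
      simp [unitItem, Item.str]
      omega
    · have h0 : n - (scanAll x y l).2 = 0 := by omega
      rw [if_pos (by simp [h0]), h0, List.replicate_zero, hm]
      exact h.mono (by omega)
  exact (h₁.seq (h₂.seq h₃)).mono (by omega)


/-! ### The rejection flag and the budgets -/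

/-- Adding a reason to reject the current candidates. -/
def Mem.orBad (m : Mem) (b : Bool) : Mem := { m with bad := m.bad || b }

/-- Reject the current candidates. -/
def setBad : Prog := flags fun v _ ans => (v, true, ans)

theorem exec_setBad_skip (m : Mem) (p : Prop) [Decidable p] :
    Exec (if p then setBad else skip) m (m.orBad (decide p)) 1 := by
  split_ifs with h
  · have := exec_flags m fun v _ ans => (v, true, ans)
    simpa [Mem.orBad, h, setBad] using this
  · simpa [Mem.orBad, h] using exec_skip m

theorem exec_skip_setBad (m : Mem) (p : Prop) [Decidable p] :
    Exec (if p then skip else setBad) m (m.orBad (decide ¬p)) 1 := by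
  have := exec_setBad_skip m (¬p)
  rwa [ite_not] at this

/-- The memory after `n` units of the budget `k` have been used. -/
def Mem.spent (m : Mem) (k : Item) (n : ℕ) : Mem :=
  { m with bud := [(decBits^[n] k.1, k.2)], bad := m.bad || decide (bitsVal k.1 < n) }

theorem exec_decOr_setBad (m : Mem) {k : Item} {n N : ℕ} (hN : k.1.length ≤ N) :
    Exec (decOr .bud setBad) (m.spent k n) (m.spent k (n + 1)) (20 * (N + 1) + 1) := by
  refine exec_decOr (l := decBits^[n] k.1) (k := k.2) (w := []) rfl
    (by rwa [length_iterate_decBits]) ?_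
  refine runs_of_eq (exec_skip_setBad _ _) (congrArg Mem.enc ?_) le_rfl
  have h : ((m.bad || decide (bitsVal k.1 < n)) || decide ¬true ∈ decBits^[n] k.1) =
      (m.bad || decide (bitsVal k.1 < n + 1)) := by
    -- Once the budget is overdrawn its bits are meaningless, but then the flag is already set and
    -- stays so; before that, the test for zero is exact.
    rcases lt_or_ge (bitsVal k.1) n with h | h
    · simp [h, h.trans n.lt_succ_self]
    · simp [true_mem_iterate_decBits h, not_lt.mpr h]
  simp only [Mem.orBad, Mem.set, Mem.spent, h, Function.iterate_succ_apply']

/-- The data of the problem, as items. -/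
structure Input where
  votes : List Item
  desp : Item
  kac : Item
  kdc : Item
  reg : List Item
  spoil : List Item

/-- The number of voters who prefer `x` to `y`. -/
def Input.pref (I : Input) (x y : Item) : ℕ := (scanAll x y I.votes).2

/-- The condition for `c` to do at least as well as the despised candidate, due to the poor
performance of the latter against `b`, does not hold. -/
def Input.bad (I : Input) (c b : Item) : Bool :=
  decide (c = I.desp) || decide (b = I.desp) ||
    decide (bitsVal I.kac.1 < I.spoil.countP fun a => decide (a = c ∨ a = b)) ||
    decide (I.pref c I.desp < I.pref I.desp b) ||
    decide (¬c = b ∧ I.pref c b < I.pref I.desp b) ||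
    decide (bitsVal I.kdc.1 <
      I.reg.countP fun e => decide (¬e = c ∧ I.pref c e < I.pref I.desp b))

/-- All sizes are bounded by `N`. -/
structure Input.Bounded (I : Input) (N : ℕ) : Prop where
  votes : ∀ x ∈ I.votes, x.1.length ≤ N
  desp : I.desp.1.length ≤ N
  kac : I.kac.1.length ≤ N
  kdc : I.kdc.1.length ≤ N
  reg : ∀ x ∈ I.reg, x.1.length ≤ N
  spoil : ∀ x ∈ I.spoil, x.1.length ≤ N
  length_votes : I.votes.length ≤ N
  length_reg : I.reg.length ≤ N
  length_spoil : I.spoil.length ≤ N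
  scan : ∀ x y, (scanAll x y I.votes).1 = none

/-- The memory during the main loops. -/
def Input.mem (I : Input) (ans : Bool) (cand cand' wit wit' : List Item) : Mem where
  v := none
  bad := false
  ans := ans
  votes := I.votes
  votes' := []
  desp := [I.desp]
  kac := [I.kac]
  kdc := [I.kdc]
  cand := cand
  cand' := cand'
  wit := wit
  wit' := wit'
  reg := I.reg
  reg' := []
  spoil := I.spoil
  spoil' := []
  cnt := []
  cnt' := []
  work := []
  bud := []

/-- Use the budget for adding candidates. -/
def countSpoilers : Prog :=
  forEach .spoil .spoil' (ifEq .spoil .cand (decOr .bud setBad)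
    (ifEq .spoil .wit (decOr .bud setBad) skip))

theorem exec_countSpoilers {m : Mem} {c b k : Item} {l w w' : List Item} {N : ℕ}
    (hc : m.cand = c :: w) (hb : m.wit = b :: w') (hl : m.spoil = l) (hl' : m.spoil' = [])
    (hkN : k.1.length ≤ N) (hN : ∀ x ∈ l, x.1.length ≤ N) (hlN : l.length ≤ N) :
    Exec countSpoilers (m.spent k 0) (m.spent k (l.countP fun a => decide (a = c ∨ a = b)))
      (N * (60 * (N + 1) + 1 + 80 * (N + 1) + 2) + 2) := by
  subst hl
  have key := exec_forEach (i := .spoil) (j := .spoil') (by decide)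
    (a := ifEq .spoil .cand (decOr .bud setBad) (ifEq .spoil .wit (decOr .bud setBad) skip))
    (fun p => m.spent k (p.countP fun a => decide (a = c ∨ a = b))) (l := m.spoil)
    (T := 60 * (N + 1) + 1) hN ?_
  · have h₁ : ∀ n, ((m.spent k n).set .spoil m.spoil).set .spoil' [] = m.spent k n := by
      intro n
      rw [← hl']
      rfl
    rw [h₁, h₁] at key
    exact key.mono (Nat.add_le_add_right (Nat.mul_le_mul_right _ hlN) 2)
  · intro p a q h
    have ha : a.1.length ≤ N := hN a (by simp [h])
    have hd := exec_decOr_setBad ((m.set .spoil (a :: q)).set .spoil' p.reverse) (k := k) (N := N)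
      (n := p.countP fun a => decide (a = c ∨ a = b)) hkN
    refine Exec.mono (exec_ifEq (i := .spoil) (j := .cand) (N := N) (t := 40 * (N + 1) + 1)
      (by decide) (x := a) (w := q) rfl hc ha ?_) (by omega)
    rw [List.countP_append]
    by_cases h₁ : a = c
    · rw [if_pos h₁, List.countP_singleton, if_pos (by simp [h₁])]
      refine hd.mono ?_
      omega
    · rw [if_neg h₁]
      refine Exec.mono (exec_ifEq (i := .spoil) (j := .wit) (N := N) (t := 20 * (N + 1) + 1)
        (by decide) (x := a) (w := q) rfl hb ha ?_) (by omega)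
      by_cases h₂ : a = b
      · rw [if_pos h₂, List.countP_singleton, if_pos (by simp [h₂])]
        exact hd
      · rw [if_neg h₂, List.countP_singleton, if_neg (by simp [h₁, h₂])]
        exact (exec_skip _).mono (by omega)

/-- Time for `ifFewer`. -/
def timeFewer (N : ℕ) : ℕ :=
  N * (1 + 80 * (N + 1) + 2) + N * (120 * (N + 1) + 7) + 2 * N + 6

/-- Use the budget for deleting candidates. -/
def countRegistered : Prog :=
  forEach .reg .reg' (ifEq .reg .cand skip (ifFewer .cand .reg (decOr .bud setBad)))

/-- The counter `cnt` holds the threshold `n`, which will be the number of voters preferring the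
despised candidate to the witness; every registered candidate against whom `c` stays below it must
be deleted, at the cost of one unit. -/
theorem exec_countRegistered {I : Input} {N : ℕ} (hI : I.Bounded N) {m : Mem} {c k : Item}
    {w : List Item} {n : ℕ}
    (hc : m.cand = c :: w) (hr : m.reg = I.reg) (hr' : m.reg' = [])
    (hl : m.votes = I.votes) (hl' : m.votes' = []) (hv : m.v = none)
    (hn : m.cnt = List.replicate n unitItem) (hn' : m.cnt' = [])
    (hw : m.work = []) (hnN : n ≤ N) (hkN : k.1.length ≤ N) :
    Exec countRegistered (m.spent k 0)
      (m.spent k (I.reg.countP fun e => decide (¬e = c ∧ I.pref c e < n)))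
      (N * (40 * (N + 1) + 1 + timeFewer N + 80 * (N + 1) + 2) + 2) := by
  have key := exec_forEach (i := .reg) (j := .reg') (by decide)
    (a := ifEq .reg .cand skip (ifFewer .cand .reg (decOr .bud setBad)))
    (fun p => m.spent k (p.countP fun e => decide (¬e = c ∧ I.pref c e < n))) (l := I.reg)
    (T := 40 * (N + 1) + 1 + timeFewer N) hI.reg ?_
  · have h₁ : ∀ n, ((m.spent k n).set .reg I.reg).set .reg' [] = m.spent k n := by
      intro n
      rw [← hr', ← hr]
      rfl
    rw [h₁, h₁] at key
    exact key.mono (Nat.add_le_add_right (Nat.mul_le_mul_right _ hI.length_reg) 2)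
  · intro p e q h
    have he : e.1.length ≤ N := hI.reg e (by simp [h])
    have hd := exec_decOr_setBad ((m.set .reg (e :: q)).set .reg' p.reverse) (k := k) (N := N)
      (n := p.countP fun e => decide (¬e = c ∧ I.pref c e < n)) hkN
    refine Exec.mono (exec_ifEq (i := .reg) (j := .cand) (N := N)
      (t := 20 * (N + 1) + 1 + timeFewer N) (by decide) (x := e) (w := q) rfl hc he ?_) (by omega)
    rw [List.countP_append]
    by_cases h₁ : e = c
    · rw [if_pos h₁, List.countP_singleton, if_neg (by simp [h₁])]
      refine (exec_skip _).mono ?_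
      omega
    · rw [if_neg h₁]
      refine Exec.mono (exec_ifFewer (x := c) (y := e) (w' := q) (n := n) (N := N)
        (t := 20 * (N + 1) + 1) (l := I.votes)
        (by decide) (by decide) (by decide) (by decide) (by decide) (by decide) hc rfl hl hl' hv hn
        hn' hw (hI.scan _ _) hI.votes hI.length_votes hnN ?_) (by unfold timeFewer; omega)
      by_cases h₂ : (scanAll c e I.votes).2 < n
      · rw [if_pos h₂, List.countP_singleton, if_pos (by simpa [h₁, Input.pref] using h₂)]
        exact hd
      · rw [if_neg h₂, List.countP_singleton, if_neg (by simpa [h₁, Input.pref] using h₂)]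
        exact (exec_skip _).mono (by omega)

/-! ### The test of one pair of candidates -/

/-- Check whether the top item of `cand` can be made to do at least as well as the despised
candidate, due to the poor performance of the latter against the top item of `wit`. -/
def check : Prog :=
  .seq (ifEq .cand .desp setBad skip) <| .seq (ifEq .wit .desp setBad skip) <|
  .seq (dup .kac .bud) <| .seq countSpoilers <| .seq (drop .bud) <|
  .seq (scan .desp .wit (pushUnit .cnt)) <|
  .seq (ifFewer .cand .desp setBad) <|
  .seq (ifEq .cand .wit skip (ifFewer .cand .wit setBad)) <|
  .seq (dup .kdc .bud) <| .seq countRegistered <| .seq (drop .bud) <|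
  .seq (clear .cnt) <|
  test (fun x => x.bad) (flags fun v _ ans => (v, false, ans)) (flags fun v bad _ => (v, bad, true))

/-- Time for `check`. -/
def timeCheck (N : ℕ) : ℕ :=
  N * (60 * (N + 1) + 1 + 80 * (N + 1) + 2) + (N * (120 * (N + 1) + 7) + 2) +
    2 * timeFewer N + N * (40 * (N + 1) + 1 + timeFewer N + 80 * (N + 1) + 2) +
      140 * (N + 1) + 2 * N + 20

theorem exec_check {I : Input} {N : ℕ} (hI : I.Bounded N) (ans : Bool) {c b : Item}
    (w w' w₂ w₂' : List Item) (hc : c.1.length ≤ N) (hb : b.1.length ≤ N) :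
    Exec check (I.mem ans (c :: w) w' (b :: w₂) w₂')
      (I.mem (ans || !I.bad c b) (c :: w) w' (b :: w₂) w₂') (timeCheck N) := by
  set m := I.mem ans (c :: w) w' (b :: w₂) w₂' with hm
  have h₁ := exec_ifEq (i := .cand) (j := .desp) (by decide) (m := m) (N := N) rfl rfl hc
    (exec_setBad_skip m (c = I.desp))
  set m₁ := m.orBad (decide (c = I.desp)) with hm₁
  have h₂ := exec_ifEq (i := .wit) (j := .desp) (by decide) (m := m₁) (N := N) rfl rfl hb
    (exec_setBad_skip m₁ (b = I.desp))
  set m₂ := m₁.orBad (decide (b = I.desp)) with hm₂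
  have h₃ := exec_dup (i := .kac) (j := .bud) (m := m₂) (N := N) (by decide) rfl hI.kac
  have e₃ : m₂.set .bud (I.kac :: m₂.get .bud) = m₂.spent I.kac 0 := by
    simp [Mem.spent, Mem.set, hm₂, hm₁, Mem.orBad, hm, Input.mem, Mem.get]
  rw [e₃] at h₃
  have h₄ := exec_countSpoilers (m := m₂) (k := I.kac) rfl rfl rfl rfl hI.kac hI.spoil
    hI.length_spoil
  set nA := I.spoil.countP fun a => decide (a = c ∨ a = b) with hnA
  set m₄ := m₂.orBad (decide (bitsVal I.kac.1 < nA)) with hm₄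
  have h₅ : Exec (drop .bud) (m₂.spent I.kac nA) m₄ (20 * (N + 1)) :=
    exec_drop (i := .bud) (m := m₂.spent I.kac nA) (w := []) rfl
      (by rw [length_iterate_decBits]; exact hI.kac)
  have h₆ := exec_scan (i := .desp) (j := .wit) (k := .cnt) (by decide) (by decide) (by decide)
    (by decide) (by decide) (by decide) (by decide) (by decide) (act := pushUnit .cnt)
    (f := fun n => n + 1)
    (fun m n hn => by rw [List.replicate_succ, ← hn]; exact exec_pushUnit m _)
    (m := m₄) (l := I.votes) (x := I.desp) (y := b) (n := 0) rfl rfl rfl rfl rfl rfl (hI.scan _ _) hI.votes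
    hI.length_votes
  set n := I.pref I.desp b with hn
  have hnN : n ≤ N := (snd_scanAll_le _ _ _).trans hI.length_votes
  have e₆ : (fun n => n + 1)^[(scanAll I.desp b I.votes).2] 0 = n := by
    simp [hn, Input.pref]
  rw [e₆] at h₆
  set m₆ := m₄.set .cnt (List.replicate n unitItem) with hm₆
  have h₇ := exec_ifFewer (i := .cand) (j := .desp) (by decide) (by decide) (by decide) (by decide)
    (by decide) (by decide) (m := m₆) (l := I.votes) (n := n) (N := N) rfl rfl rfl rfl rfl rfl rfl rfl
    (hI.scan _ _) hI.votes hI.length_votes hnN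
    (exec_setBad_skip m₆ ((scanAll c I.desp I.votes).2 < n))
  set m₇ := m₆.orBad (decide ((scanAll c I.desp I.votes).2 < n)) with hm₇
  set m₈ := m₇.orBad (decide (¬c = b ∧ I.pref c b < n)) with hm₈
  have h₈ : Exec (ifEq .cand .wit skip (ifFewer .cand .wit setBad)) m₇ m₈
      (20 * (N + 1) + (timeFewer N + 1)) := by
    refine exec_ifEq (by decide) rfl rfl hc ?_
    by_cases hcb : c = b
    · rw [if_pos hcb]
      have : m₈ = m₇ := by simp [hm₈, hcb, Mem.orBad]
      rw [this]
      exact (exec_skip _).mono (by omega)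
    · rw [if_neg hcb]
      have := exec_ifFewer (i := .cand) (j := .wit) (by decide) (by decide) (by decide) (by decide)
        (by decide) (by decide) (m := m₇) (l := I.votes) (n := n) (N := N) rfl rfl rfl rfl rfl rfl rfl rfl
        (hI.scan _ _) hI.votes hI.length_votes hnN
        (exec_setBad_skip m₇ ((scanAll c b I.votes).2 < n))
      have e : m₈ = m₇.orBad (decide ((scanAll c b I.votes).2 < n)) := by
        simp [hm₈, hcb, Input.pref]
      rw [e]
      exact this
  have h₉ := exec_dup (i := .kdc) (j := .bud) (m := m₈) (N := N) (by decide) rfl hI.kdc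
  have e₉ : m₈.set .bud (I.kdc :: m₈.get .bud) = m₈.spent I.kdc 0 := by
    have : m₈.get .bud = [] := rfl
    rw [this]
    simp [Mem.spent, Mem.set]
  rw [e₉] at h₉
  have h₁₀ := exec_countRegistered hI (m := m₈) (k := I.kdc) (n := n) rfl rfl rfl rfl rfl rfl rfl
    rfl rfl hnN hI.kdc
  set nC := I.reg.countP fun e => decide (¬e = c ∧ I.pref c e < n) with hnC
  set m₁₁ := m₈.orBad (decide (bitsVal I.kdc.1 < nC)) with hm₁₁
  have h₁₁ : Exec (drop .bud) (m₈.spent I.kdc nC) m₁₁ (20 * (N + 1)) :=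
    exec_drop (i := .bud) (m := m₈.spent I.kdc nC) (w := []) rfl
      (by rw [length_iterate_decBits]; exact hI.kdc)
  have h₁₂ := exec_clear m₁₁ .cnt
  have e₁₂ : ((m₁₁.get .cnt).flatMap Item.str).length = n := by
    have : m₁₁.get .cnt = List.replicate n unitItem := rfl
    rw [this]
    simp [unitItem, Item.str]
  rw [e₁₂] at h₁₂
  -- The flag, initially `false`, has collected the six disjuncts of `Input.bad` in the order in
  -- which they are listed there.
  have hbad : m₁₁.bad = I.bad c b := rfl
  have h₁₃ : Exec (test (fun x => x.bad) (flags fun v _ ans => (v, false, ans))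
      (flags fun v bad _ => (v, bad, true))) (m₁₁.set .cnt [])
        (I.mem (ans || !I.bad c b) (c :: w) w' (b :: w₂) w₂') 2 := by
    refine exec_test (t := 1) ?_
    rw [Mem.register_set]
    change Exec (if m₁₁.bad = true then _ else _) _ _ _
    rw [hbad]
    cases hbad' : I.bad c b
    · rw [if_neg (by simp)]
      refine runs_of_eq (exec_flags _ _) (congrArg Mem.enc ?_) le_rfl
      rw [hbad'] at hbad
      change { I.mem true (c :: w) w' (b :: w₂) w₂' with bad := m₁₁.bad } = _
      rw [hbad]
      simp
      rfl
    · rw [if_pos rfl]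
      refine runs_of_eq (exec_flags _ _) (congrArg Mem.enc ?_) le_rfl
      simp
      rfl
  refine (h₁.seq <| h₂.seq <| h₃.seq <| h₄.seq <| h₅.seq <| h₆.seq <| h₇.seq <| h₈.seq <| h₉.seq <|
    h₁₀.seq <| h₁₁.seq <| h₁₂.seq h₁₃).mono ?_
  unfold timeCheck timeFewer
  omega


/-! ### The search over all pairs -/

/-- Try all pairs of candidates. -/
def search : Prog := forEach .cand .cand' (forEach .wit .wit' check)

theorem exec_search {I : Input} {N : ℕ} (hI : I.Bounded N) {l : List Item}
    (hl : ∀ x ∈ l, x.1.length ≤ N) (hlN : l.length ≤ N) :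
    Exec search (I.mem false l [] l []) (I.mem (l.any fun c => l.any fun b => !I.bad c b) l [] l [])
      (N * (N * (timeCheck N + 80 * (N + 1) + 2) + 2 + 80 * (N + 1) + 2) + 2) := by
  have inner : ∀ (ans : Bool) c w w', c.1.length ≤ N → Exec (forEach .wit .wit' check)
      (I.mem ans (c :: w) w' l []) (I.mem (ans || l.any fun b => !I.bad c b) (c :: w) w' l [])
      (N * (timeCheck N + 80 * (N + 1) + 2) + 2) := by
    intro ans c w w' hc
    have key := exec_forEach (i := .wit) (j := .wit') (by decide) (a := check)
      (fun p => I.mem (ans || p.any fun b => !I.bad c b) (c :: w) w' [] []) hl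
      (T := timeCheck N) fun p b q h => by
        have := exec_check hI (ans || p.any fun b => !I.bad c b) w w' q p.reverse hc
          (hl b (by simp [h]))
        rw [List.any_append, List.any_cons, List.any_nil, Bool.or_false, ← Bool.or_assoc]
        exact this
    rw [List.any_nil, Bool.or_false] at key
    exact key.mono (Nat.add_le_add_right (Nat.mul_le_mul_right _ hlN) 2)
  have key := exec_forEach (i := .cand) (j := .cand') (by decide) (a := forEach .wit .wit' check)
    (fun p => I.mem (p.any fun c => l.any fun b => !I.bad c b) [] [] l []) hl
    (T := N * (timeCheck N + 80 * (N + 1) + 2) + 2) fun p c q h => by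
      have := inner (p.any fun c => l.any fun b => !I.bad c b) c q p.reverse (hl c (by simp [h]))
      rw [List.any_append, List.any_cons, List.any_nil, Bool.or_false]
      exact this
  exact key.mono (Nat.add_le_add_right (Nat.mul_le_mul_right _ hlN) 2)

/-! ### Reading the input -/

/-- Read a list of candidates from the input up to the closing bracket. -/
def loadList (i : Var) : Prog :=
  .loop (some .votes) (fun _ s => decide (s ≠ some .ket))
    (.seq (dup .votes i) (.seq (dup .votes .cand) (mv .votes .wit)))

/-- The memory after a list of candidates has been read. -/
def Mem.loaded (m : Mem) (i : Var) (l r : List Item) : Mem :=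
  (((m.set i (l.reverse ++ m.get i)).set .cand (l.reverse ++ m.cand)).set .wit
    (l.reverse ++ m.wit)).set .votes r

/-- Moving from stack to stack reverses the list. Each candidate also goes to `cand` and `wit`,
which end up listing all candidates for the two nested loops of `search`. -/
theorem exec_loadList {i : Var} (hi : i = .reg ∨ i = .spoil) {m : Mem} {l r : List Item} {N : ℕ}
    (h : m.votes = l ++ ketItem :: r) (hl : ketItem ∉ l) (hN : ∀ x ∈ l, x.1.length ≤ N) :
    Exec (loadList i) m (m.loaded i l (ketItem :: r)) (l.length * (80 * (N + 1) + 1) + 1) := by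
  induction l generalizing m with
  | nil =>
    have e : m.loaded i [] (ketItem :: r) = m := by
      rw [List.nil_append] at h
      rw [← h]
      rcases hi with rfl | rfl <;> rfl
    rw [e]
    have := (Mem.head?_stack_eq_ket (m := m) (i := .votes) h).2 rfl
    exact (Cmd.Runs.loop_false (by rw [this]; rfl)).mono (by omega)
  | cons x l ih =>
    have hx : x.1.length ≤ N := hN x (by simp)
    have hne : x ≠ ketItem := fun e => hl (by simp [e])
    have hk : (m.stack (some .votes)).head? ≠ some Γ'.ket := fun e =>
      hne ((Mem.head?_stack_eq_ket (m := m) (i := .votes) h).1 e)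
    have hiv : Var.votes ≠ i := by rcases hi with rfl | rfl <;> decide
    have h₁ := exec_dup hiv (m := m) h hx
    have h₂ := exec_dup (i := .votes) (j := .cand) (by decide) (m := m.set i (x :: m.get i))
      (x := x) (w := l ++ ketItem :: r) (by rw [Mem.get_set_of_ne _ hiv]; exact h) hx
    have h₃ := exec_mv (i := .votes) (j := .wit) (by decide)
      (m := (m.set i (x :: m.get i)).set .cand (x :: (m.set i (x :: m.get i)).get .cand))
      (x := x) (w := l ++ ketItem :: r)
      (by rw [Mem.get_set_of_ne _ (by decide), Mem.get_set_of_ne _ hiv]; exact h) hx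
    have h₄ := ih (m := m.loaded i [x] (l ++ ketItem :: r)) rfl (fun h => hl (by simp [h]))
      fun y hy => hN y (by simp [hy])
    have e : (m.loaded i [x] (l ++ ketItem :: r)).loaded i l (ketItem :: r) =
        m.loaded i (x :: l) (ketItem :: r) := by
      rcases hi with rfl | rfl <;> simp [Mem.loaded, Mem.set, Mem.get]
    rw [e] at h₄
    have h₅ : Exec (.seq (dup .votes i) (.seq (dup .votes .cand) (mv .votes .wit))) m
        (m.loaded i [x] (l ++ ketItem :: r)) (80 * (N + 1)) := by
      refine runs_of_eq (h₁.seq (h₂.seq h₃)) (congrArg Mem.enc ?_) (by omega)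
      rcases hi with rfl | rfl <;> rfl
    refine (Cmd.Runs.loop_true (by simpa using hk) h₅ h₄).mono ?_
    simp only [List.length_cons, add_mul]
    omega

/-- Read the input up to the votes. -/
def load : Prog :=
  .seq (drop .votes) <| .seq (mv .votes .desp) <| .seq (mv .votes .kac) <|
  .seq (mv .votes .kdc) <| .seq (drop .votes) <| .seq (drop .votes) <|
  .seq (loadList .reg) <| .seq (drop .votes) <| .seq (drop .votes) <|
  .seq (loadList .spoil) (drop .votes)

/-- The memory without any items. -/
def Mem.empty (ans : Bool) : Mem :=
  ⟨none, false, ans, [], [], [], [], [], [], [], [], [], [], [], [], [], [], [], [], []⟩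

/-- The item that starts a list. -/
abbrev braItem : Item := ([], .bra)

/-- The items of the input string. The candidates are listed in reverse order. -/
def Input.items (I : Input) : List Item :=
  braItem :: I.desp :: I.kac :: I.kdc :: ketItem :: braItem :: (I.reg.reverse ++
    ketItem :: braItem :: (I.spoil.reverse ++ ketItem :: I.votes))

/-- The input stack is the variable `votes`: what remains after the header and the two candidate
lists is the sequence of votes, brackets included, as the traversal expects it. -/
theorem exec_load {I : Input} {N : ℕ} (hI : I.Bounded N) (hr : ketItem ∉ I.reg)
    (hs : ketItem ∉ I.spoil) :
    Exec load ((Mem.empty false).set .votes I.items)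
      (I.mem false (I.spoil ++ I.reg) [] (I.spoil ++ I.reg) [])
      (2 * (N * (80 * (N + 1) + 1) + 1) + 240 * (N + 1)) := by
  have h0 : ([] : List Bool).length ≤ N := Nat.zero_le _
  have h₁ := exec_drop (i := .votes) (m := (Mem.empty false).set .votes I.items) rfl h0
  have h₂ := exec_mv (i := .votes) (j := .desp) (by decide) (m := (Mem.empty false).set .votes
    I.items.tail) rfl hI.desp
  have h₃ := exec_mv (i := .votes) (j := .kac) (by decide) (m := { Mem.empty false with
    votes := I.items.tail.tail, desp := [I.desp] }) rfl hI.kac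
  have h₄ := exec_mv (i := .votes) (j := .kdc) (by decide) (m := { Mem.empty false with
    votes := I.items.tail.tail.tail, desp := [I.desp], kac := [I.kac] }) rfl hI.kdc
  have h₅ := exec_drop (i := .votes) (m := { Mem.empty false with
    votes := I.items.tail.tail.tail.tail, desp := [I.desp], kac := [I.kac], kdc := [I.kdc] }) rfl h0
  have h₆ := exec_drop (i := .votes) (m := { Mem.empty false with
    votes := I.items.tail.tail.tail.tail.tail, desp := [I.desp], kac := [I.kac], kdc := [I.kdc] })
    rfl h0
  have h₇ := exec_loadList (i := .reg) (.inl rfl) (N := N) (m := { Mem.empty false with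
    votes := I.items.tail.tail.tail.tail.tail.tail, desp := [I.desp], kac := [I.kac],
    kdc := [I.kdc] }) (l := I.reg.reverse) rfl (by simpa using hr) (by simpa using hI.reg)
  have e₇ : (Mem.loaded { Mem.empty false with
      votes := I.items.tail.tail.tail.tail.tail.tail, desp := [I.desp], kac := [I.kac],
      kdc := [I.kdc] } .reg I.reg.reverse (ketItem :: braItem ::
        (I.spoil.reverse ++ ketItem :: I.votes))) = { Mem.empty false with
      votes := ketItem :: braItem :: (I.spoil.reverse ++ ketItem :: I.votes), desp := [I.desp],
      kac := [I.kac], kdc := [I.kdc], reg := I.reg, cand := I.reg, wit := I.reg } := by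
    simp [Mem.loaded, Mem.empty, Mem.set, Mem.get]
  rw [e₇] at h₇
  have h₈ := exec_drop (i := .votes) (m := { Mem.empty false with
      votes := ketItem :: braItem :: (I.spoil.reverse ++ ketItem :: I.votes), desp := [I.desp],
      kac := [I.kac], kdc := [I.kdc], reg := I.reg, cand := I.reg, wit := I.reg }) rfl h0
  have h₉ := exec_drop (i := .votes) (m := { Mem.empty false with
      votes := braItem :: (I.spoil.reverse ++ ketItem :: I.votes), desp := [I.desp],
      kac := [I.kac], kdc := [I.kdc], reg := I.reg, cand := I.reg, wit := I.reg }) rfl h0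
  have h₁₀ := exec_loadList (i := .spoil) (.inr rfl) (N := N) (m := { Mem.empty false with
      votes := I.spoil.reverse ++ ketItem :: I.votes, desp := [I.desp],
      kac := [I.kac], kdc := [I.kdc], reg := I.reg, cand := I.reg, wit := I.reg })
    (l := I.spoil.reverse) rfl (by simpa using hs) (by simpa using hI.spoil)
  have e₁₀ : (Mem.loaded { Mem.empty false with
      votes := I.spoil.reverse ++ ketItem :: I.votes, desp := [I.desp],
      kac := [I.kac], kdc := [I.kdc], reg := I.reg, cand := I.reg, wit := I.reg } .spoil
        I.spoil.reverse (ketItem :: I.votes)) = { I.mem false (I.spoil ++ I.reg) []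
          (I.spoil ++ I.reg) [] with votes := ketItem :: I.votes } := by
    simp [Mem.loaded, Mem.empty, Mem.set, Mem.get, Input.mem]
  rw [e₁₀] at h₁₀
  have h₁₁ := exec_drop (i := .votes) (m := { I.mem false (I.spoil ++ I.reg) []
          (I.spoil ++ I.reg) [] with votes := ketItem :: I.votes }) rfl h0
  refine (h₁.seq <| h₂.seq <| h₃.seq <| h₄.seq <| h₅.seq <| h₆.seq <| h₇.seq <| h₈.seq <| h₉.seq <|
    h₁₀.seq h₁₁).mono ?_
  have hrN := Nat.mul_le_mul_right (80 * (N + 1) + 1) hI.length_reg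
  have hsN := Nat.mul_le_mul_right (80 * (N + 1) + 1) hI.length_spoil
  simp only [List.length_reverse]
  omega

/-! ### Cleanup and total running time -/

/-- Empty the memory. -/
def cleanup : Prog :=
  .seq (clear .votes) <| .seq (clear .desp) <| .seq (clear .kac) <| .seq (clear .kdc) <|
  .seq (clear .cand) <| .seq (clear .wit) <| .seq (clear .reg) (clear .spoil)

theorem length_flatMap_str_le {l : List Item} {N : ℕ} (h : ∀ x ∈ l, x.1.length ≤ N) :
    (l.flatMap Item.str).length ≤ l.length * (N + 1) := by
  induction l with
  | nil => simp
  | cons x l ih =>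
    have h₁ := ih fun y hy => h y (by simp [hy])
    have h₂ := h x (by simp)
    simp only [List.flatMap_cons, List.length_append, Item.length_str, List.length_cons, add_mul]
    omega

theorem exec_clear_of_le {m : Mem} {i : Var} {N : ℕ}
    (h : ∀ x ∈ m.get i, x.1.length ≤ N) (hN : (m.get i).length ≤ N + 1) :
    Exec (clear i) m (m.set i []) (2 * ((N + 1) * (N + 1)) + 1) := by
  refine (exec_clear m i).mono ?_
  have := (length_flatMap_str_le h).trans (Nat.mul_le_mul_right _ hN)
  omega

theorem exec_clear_seq {m m' : Mem} {i : Var} {c : Prog} {N t : ℕ}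
    (h : ∀ x ∈ m.get i, x.1.length ≤ N) (hN : (m.get i).length ≤ N + 1)
    (hc : Exec c (m.set i []) m' t) :
    Exec (.seq (clear i) c) m m' (2 * ((N + 1) * (N + 1)) + 1 + t) :=
  (exec_clear_of_le h hN).seq hc

theorem exec_cleanup {I : Input} {N : ℕ} (hI : I.Bounded N) (ans : Bool) {l : List Item}
    (hl : ∀ x ∈ l, x.1.length ≤ N) (hlN : l.length ≤ N) :
    Exec cleanup (I.mem ans l [] l []) (Mem.empty ans) (8 * (2 * ((N + 1) * (N + 1)) + 1)) := by
  have one : ∀ x : Item, x.1.length ≤ N → ∀ y ∈ [x], y.1.length ≤ N := by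
    intro x hx y hy
    rwa [List.mem_singleton.1 hy]
  have hs (x : Item) : [x].length ≤ N + 1 := by simp
  refine Exec.mono (exec_clear_seq hI.votes (hI.length_votes.trans N.le_succ) <|
    exec_clear_seq (one _ hI.desp) (hs _) <|
    exec_clear_seq (one _ hI.kac) (hs _) <|
    exec_clear_seq (one _ hI.kdc) (hs _) <|
    exec_clear_seq hl (hlN.trans N.le_succ) <|
    exec_clear_seq hl (hlN.trans N.le_succ) <|
    exec_clear_seq hI.reg (hI.length_reg.trans N.le_succ) <|
    exec_clear_of_le hI.spoil (hI.length_spoil.trans N.le_succ)) ?_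
  omega

/-- The program that decides the problem. -/
def solve : Prog := .seq load (.seq search cleanup)

/-- Time for `solve`. -/
def timeSolve (N : ℕ) : ℕ :=
  (2 * (N * (80 * (N + 1) + 1) + 1) + 240 * (N + 1)) +
    ((N * (N * (timeCheck N + 80 * (N + 1) + 2) + 2 + 80 * (N + 1) + 2) + 2) +
      8 * (2 * ((N + 1) * (N + 1)) + 1))

theorem exec_solve {I : Input} {N : ℕ} (hI : I.Bounded N) (hr : ketItem ∉ I.reg)
    (hs : ketItem ∉ I.spoil) (hN : (I.spoil ++ I.reg).length ≤ N) :
    Exec solve ((Mem.empty false).set .votes I.items)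
      (Mem.empty ((I.spoil ++ I.reg).any fun c => (I.spoil ++ I.reg).any fun b => !I.bad c b))
      (timeSolve N) := by
  have hl : ∀ x ∈ I.spoil ++ I.reg, x.1.length ≤ N := by
    intro x hx
    rcases List.mem_append.1 hx with hx | hx
    exacts [hI.spoil x hx, hI.reg x hx]
  exact (exec_load hI hr hs).seq ((exec_search hI hl hN).seq (exec_cleanup hI _ hl hN))

-- The bound is built from its argument and constants by sums and products, under which evaluations
-- of polynomials are closed.
open Polynomial in
theorem exists_polynomial_timeSolve : ∃ p : ℕ[X], ∀ n, p.eval n = timeSolve n := by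
  have hadd : ∀ {f g : ℕ → ℕ}, (∃ p : ℕ[X], ∀ n, p.eval n = f n) →
      (∃ p : ℕ[X], ∀ n, p.eval n = g n) → ∃ p : ℕ[X], ∀ n, p.eval n = f n + g n := by
    rintro f g ⟨p, hp⟩ ⟨q, hq⟩
    exact ⟨p + q, fun n => by simp [hp, hq]⟩
  have hmul : ∀ {f g : ℕ → ℕ}, (∃ p : ℕ[X], ∀ n, p.eval n = f n) →
      (∃ p : ℕ[X], ∀ n, p.eval n = g n) → ∃ p : ℕ[X], ∀ n, p.eval n = f n * g n := by
    rintro f g ⟨p, hp⟩ ⟨q, hq⟩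
    exact ⟨p * q, fun n => by simp [hp, hq]⟩
  have hX : ∃ p : ℕ[X], ∀ n, p.eval n = n := ⟨X, fun n => by simp⟩
  have hC : ∀ c : ℕ, ∃ p : ℕ[X], ∀ n : ℕ, p.eval n = c := fun c => ⟨C c, fun n => by simp⟩
  unfold timeSolve timeCheck timeFewer
  repeat first | exact hX | exact hC _ | apply hadd | apply hmul

end ACDC

/-! ### The combinatorial characterization -/

/-- Filtering keeps the relative order of the entries that survive. Neither `a` nor `b` needs to
occur in `v`, because `idxOf` of a missing entry is the length. -/
theorem idxOf_filter_lt_iff {p : ℕ → Bool} {a b : ℕ} (ha : p a = true) (hb : p b = true)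
    (v : List ℕ) :
    (v.filter p).idxOf a < (v.filter p).idxOf b ↔ v.idxOf a < v.idxOf b := by
  induction v with
  | nil => simp
  | cons z v ih =>
    by_cases hz : p z = true
    · rw [List.filter_cons_of_pos hz, List.idxOf_cons, List.idxOf_cons, List.idxOf_cons,
        List.idxOf_cons]
      cases z == a <;> cases z == b <;> simp [ih]
    · have hza : z ≠ a := fun h => hz (h ▸ ha)
      have hzb : z ≠ b := fun h => hz (h ▸ hb)
      rw [List.filter_cons_of_neg hz, List.idxOf_cons_ne _ hza, List.idxOf_cons_ne _ hzb, ih]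
      simp

theorem Election.restrict_N {E : Election} {S : Finset ℕ} {a b : ℕ} (ha : a ∈ S) (hb : b ∈ S) :
    (E.restrict S).N a b = E.N a b := by
  simp only [Election.N, Election.restrict, List.countP_map]
  refine List.countP_congr fun v _ => ?_
  simpa using idxOf_filter_lt_iff (p := fun c => decide (c ∈ S)) (by simpa) (by simpa) v

/-- The presence of `c` makes the minimum defining the score of `d` one over a nonempty set, so it
is attained at some `b`; the score of `c` is at least this value if and only if every term of its
minimum is. -/
theorem maximinScore_le_iff {E : Election} {c d : ℕ} (hc : c ∈ E.candidates) (hcd : c ≠ d) :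
    maximinScore E d ≤ maximinScore E c ↔
      ∃ b ∈ E.candidates, b ≠ d ∧ ∀ e ∈ E.candidates, e ≠ c → E.N d b ≤ E.N c e := by
  obtain ⟨b, hb, hbd⟩ := Finset.exists_mem_eq_inf (E.candidates.erase d)
    ⟨c, Finset.mem_erase.2 ⟨hcd, hc⟩⟩ fun b => (E.N d b : ℕ∞)
  unfold maximinScore
  constructor
  · intro h
    rw [Finset.mem_erase] at hb
    refine ⟨b, hb.2, hb.1, fun e he hec => ?_⟩
    rw [hbd, Finset.le_inf_iff] at h
    exact_mod_cast h e (Finset.mem_erase.2 ⟨hec, he⟩)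
  · rintro ⟨b, hb, hbd, h⟩
    refine (Finset.inf_le (Finset.mem_erase.2 ⟨hbd, hb⟩)).trans (Finset.le_inf fun e he => ?_)
    rw [Finset.mem_erase] at he
    exact_mod_cast h e he.2 he.1

/-- If every rival scores strictly less than `d`, then `d` alone wins. Conversely, a rival scoring
at least as much as a winning `d` wins as well. -/
theorem not_uniqueWinner_maximin_iff {E : Election} {d : ℕ} (hd : d ∈ E.candidates) :
    ¬maximin.UniqueWinner E d ↔ ∃ c ∈ E.candidates, c ≠ d ∧ ∃ b ∈ E.candidates, b ≠ d ∧
      ∀ e ∈ E.candidates, e ≠ c → E.N d b ≤ E.N c e := by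
  have key : ¬maximin.UniqueWinner E d ↔
      ∃ c ∈ E.candidates, c ≠ d ∧ maximinScore E d ≤ maximinScore E c := by
    constructor
    · contrapose!
      intro h
      unfold ElectionSystem.UniqueWinner
      ext c
      simp only [maximin, Finset.mem_filter, Finset.mem_singleton]
      constructor
      · rintro ⟨hc, hmax⟩
        by_contra hcd
        exact absurd (hmax d hd) (not_le.2 (h c hc hcd))
      · rintro rfl
        refine ⟨hd, fun b hb => ?_⟩
        by_cases hbc : b = c
        · rw [hbc]
        · exact (h b hb hbc).le
    · rintro ⟨c, hc, hcd, hle⟩ h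
      have hdw : d ∈ maximin.winners E := by rw [h]; simp
      have hcw : c ∈ maximin.winners E := by
        simp only [maximin, Finset.mem_filter] at hdw ⊢
        exact ⟨hc, fun b hb => (hdw.2 b hb).trans hle⟩
      rw [h, Finset.mem_singleton] at hcw
      exact hcd hcw
  rw [key]
  refine exists_congr fun c => and_congr_right fun hc => and_congr_right fun hcd => ?_
  exact maximinScore_le_iff hc hcd

/-! ### The criterion for control by a pair of candidates -/

namespace ACDCInstance

theorem mem_controlled {I : ACDCInstance} {A' C' : Finset ℕ} (hA' : A' ⊆ I.A) {c : ℕ} :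
    c ∈ (I.controlled A' C').candidates ↔ c ∈ I.C ∧ c ∉ C' ∨ c ∈ A' := by
  simp only [controlled, Election.restrict, full, Finset.mem_inter, Finset.mem_union,
    Finset.mem_sdiff]
  constructor
  · exact fun h => h.2
  · exact fun h => ⟨h.imp And.left (fun h => hA' h), h⟩

theorem controlled_N {I : ACDCInstance} {A' C' : Finset ℕ} {a b : ℕ}
    (ha : a ∈ (I.controlled A' C').candidates) (hb : b ∈ (I.controlled A' C').candidates) :
    (I.controlled A' C').N a b = I.full.N a b :=
  Election.restrict_N (Finset.mem_inter.1 ha).2 (Finset.mem_inter.1 hb).2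

theorem disjoint (I : ACDCInstance) {c : ℕ} (hC : c ∈ I.C) (hA : c ∈ I.A) : False := by
  simp only [C, A, List.mem_toFinset] at hC hA
  exact List.disjoint_of_nodup_append I.nodup hC hA

/-- The filtered sets are the least ones that any successful action for the pair must add and
delete, so they fit into the budgets whenever some action does; conversely they form a successful
action themselves. The two inequalities between votes keep `d` and `b` out of the deleted set, and
the second also covers a witness `b` that is a spoiler. -/
theorem isYes_maximin_iff (I : ACDCInstance) : I.IsYes maximin ↔
    ∃ c ∈ I.C ∪ I.A, ∃ b ∈ I.C ∪ I.A, c ≠ I.despised ∧ b ≠ I.despised ∧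
      (I.A.filter fun a => a = c ∨ a = b).card ≤ I.kAC ∧
      I.full.N I.despised b ≤ I.full.N c I.despised ∧
      (c ≠ b → I.full.N I.despised b ≤ I.full.N c b) ∧
      (I.C.filter fun e => e ≠ c ∧ I.full.N c e < I.full.N I.despised b).card ≤ I.kDC := by
  have hd : I.despised ∈ I.C := by simpa [C] using I.despised_mem
  have hsub : ∀ {A' C' : Finset ℕ}, A' ⊆ I.A → ∀ {c}, c ∈ (I.controlled A' C').candidates →
      c ∈ I.C ∪ I.A := fun hA' c hc =>
    Finset.mem_union.2 (((mem_controlled hA').1 hc).imp And.left fun h => hA' h)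
  constructor
  · rintro ⟨A', C', hA', hC', hdC', hkA, hkC, hw⟩
    have hdm : I.despised ∈ (I.controlled A' C').candidates :=
      (mem_controlled hA').2 (.inl ⟨hd, hdC'⟩)
    obtain ⟨c, hc, hcd, b, hb, hbd, h⟩ := (not_uniqueWinner_maximin_iff hdm).1 hw
    have h' : ∀ e ∈ (I.controlled A' C').candidates, e ≠ c →
        I.full.N I.despised b ≤ I.full.N c e := fun e he hec => by
      rw [← controlled_N hdm hb, ← controlled_N hc he]
      exact h e he hec
    -- A participating spoiler cannot be registered, so it must have been added and paid for.
    have hmemA : ∀ x ∈ (I.controlled A' C').candidates, x ∈ I.A → x ∈ A' := fun x hx hxA =>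
      ((mem_controlled hA').1 hx).elim (fun hxC => (I.disjoint hxC.1 hxA).elim) id
    refine ⟨c, hsub hA' hc, b, hsub hA' hb, hcd, hbd, ?_, h' _ hdm hcd.symm,
      fun hcb => h' _ hb hcb.symm, ?_⟩
    · refine (Finset.card_le_card fun a ha => ?_).trans hkA
      obtain ⟨haA, rfl | rfl⟩ := Finset.mem_filter.1 ha
      exacts [hmemA _ hc haA, hmemA _ hb haA]
    · refine (Finset.card_le_card fun e he => ?_).trans hkC
      obtain ⟨heC, hec, hlt⟩ := Finset.mem_filter.1 he
      by_contra heC'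
      exact absurd (h' e ((mem_controlled hA').2 (.inl ⟨heC, heC'⟩)) hec) (not_le.2 hlt)
  · rintro ⟨c, hc, b, hb, hcd, hbd, hkA, h₁, h₂, hkC⟩
    have hA' : (I.A.filter fun a => a = c ∨ a = b) ⊆ I.A := Finset.filter_subset _ _
    have hdC : I.despised ∉
        I.C.filter fun e => e ≠ c ∧ I.full.N c e < I.full.N I.despised b := fun h =>
      absurd h₁ (not_le.2 (Finset.mem_filter.1 h).2.2)
    refine ⟨I.A.filter fun a => a = c ∨ a = b,
      I.C.filter fun e => e ≠ c ∧ I.full.N c e < I.full.N I.despised b, hA',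
      Finset.filter_subset _ _, hdC, hkA, hkC, ?_⟩
    · have hdm := (mem_controlled hA' (c := I.despised)).2 (.inl ⟨hd, hdC⟩)
      have hcm := (mem_controlled hA' (c := c)
          (C' := I.C.filter fun e => e ≠ c ∧ I.full.N c e < I.full.N I.despised b)).2 <| by
        rcases Finset.mem_union.1 hc with hcC | hcA
        · exact .inl ⟨hcC, fun h => (Finset.mem_filter.1 h).2.1 rfl⟩
        · exact .inr (Finset.mem_filter.2 ⟨hcA, .inl rfl⟩)
      have hbm := (mem_controlled hA' (c := b)
          (C' := I.C.filter fun e => e ≠ c ∧ I.full.N c e < I.full.N I.despised b)).2 <| by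
        rcases Finset.mem_union.1 hb with hbC | hbA
        · refine .inl ⟨hbC, fun h => ?_⟩
          obtain ⟨_, hbc, hlt⟩ := Finset.mem_filter.1 h
          exact absurd (h₂ hbc.symm) (not_le.2 hlt)
        · exact .inr (Finset.mem_filter.2 ⟨hbA, .inr rfl⟩)
      refine (not_uniqueWinner_maximin_iff hdm).2 ⟨c, hcm, hcd, b, hbm, hbd, fun e he hec => ?_⟩
      rw [controlled_N hdm hbm, controlled_N hcm he]
      -- A registered opponent that `c` does not match has been deleted; an added opponent other
      -- than `c` can only be `b`.
      rcases (mem_controlled hA').1 he with ⟨heC, heC'⟩ | heA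
      · by_contra hlt
        exact heC' (Finset.mem_filter.2 ⟨heC, hec, not_le.1 hlt⟩)
      · obtain ⟨_, rfl | rfl⟩ := Finset.mem_filter.1 heA
        · exact absurd rfl hec
        · exact h₂ hec.symm

end ACDCInstance

/-- A spoiler candidate whom all voters rank first dethrones the despised candidate. -/
theorem susceptible_maximin : maximin.SusceptibleToDestructiveACDC := by
  let I : ACDCInstance :=
    { registered := [0, 1], spoilers := [2], votes := [[2, 0, 1]], despised := 0, kAC := 1,
      kDC := 0, nodup := by decide, votes_perm := by decide, despised_mem := by decide }
  refine ⟨I, ?_, {2}, ∅, by decide, by decide, by decide, by decide, by decide, ?_⟩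
  -- Winners are defined classically and do not evaluate; the characterization has only bounded
  -- quantifiers over explicit sets, which `decide` can settle.
  · by_contra h
    rw [not_uniqueWinner_maximin_iff (by decide)] at h
    revert h
    decide
  · rw [not_uniqueWinner_maximin_iff (by decide)]
    decide

/-! ### The input of the machine -/

theorem bitsVal_encodePosNum (p : PosNum) : bitsVal (Computability.encodePosNum p) = p := by
  induction p with
  | one => rfl
  | bit0 p ih =>
    rw [PosNum.cast_bit0, ← ih]
    simp only [Computability.encodePosNum, bitsVal, Bool.toNat_false]
    omega
  | bit1 p ih =>
    rw [PosNum.cast_bit1, ← ih]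
    simp only [Computability.encodePosNum, bitsVal, Bool.toNat_true]
    omega

theorem bitsVal_encodeNat (n : ℕ) : bitsVal (Computability.encodeNat n) = n := by
  have h (m : Num) : bitsVal (Computability.encodeNum m) = m := by
    cases m with
    | zero => rfl
    | pos p => exact bitsVal_encodePosNum p
  exact (h n).trans (Num.to_of_nat n)

namespace ACDC

/-- The item of a number. -/
def numItem (n : ℕ) : Item := (Computability.encodeNat n, .comma)

theorem numItem_inj {a b : ℕ} : numItem a = numItem b ↔ a = b := by
  refine ⟨fun h => ?_, congrArg _⟩
  rw [← Computability.decode_encodeNat a, ← Computability.decode_encodeNat b]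
  exact congrArg _ (congrArg Prod.fst h)

/-- The items of a list of numbers. -/
def listItems (l : List ℕ) : List Item := braItem :: (l.map numItem ++ [ketItem])

theorem flatMap_str_listItems (l : List ℕ) :
    (listItems l).flatMap Item.str = encodeNumberList l := by
  have h : (l.map numItem).flatMap Item.str = l.flatMap encodeNumber := by
    rw [List.flatMap_map]
    rfl
  simp only [listItems, List.flatMap_cons, List.flatMap_append, h, encodeNumberList]
  rfl

theorem foldl_scanStep_map_some (x y : Item) (t : Bool) (n : ℕ) (v : List ℕ) :
    (v.map numItem).foldl (scanStep x y) (some t, n) = (some t, n) := by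
  induction v with
  | nil => rfl
  | cons z v ih =>
    have : numItem z ≠ ketItem := by simp [numItem]
    simpa [scanStep, this] using ih

/-- The first of the two names met in the list decides. The equivalence also holds when names are
missing, by the default value of `idxOf`, and when they coincide, because `scanStep` tests for the
second name first. -/
theorem foldl_scanStep_map_none (a b n : ℕ) (v : List ℕ) :
    ∃ s, (v.map numItem).foldl (scanStep (numItem a) (numItem b)) (none, n) = (s, n) ∧
      (s = some true ↔ v.idxOf a < v.idxOf b) := by
  induction v with
  | nil => exact ⟨none, rfl, by simp⟩
  | cons z v ih =>
    have hz : numItem z ≠ ketItem := by simp [numItem]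
    rw [List.map_cons, List.foldl_cons]
    by_cases hb : z = b
    · subst hb
      refine ⟨some false, ?_, by simp⟩
      simpa [scanStep, hz] using foldl_scanStep_map_some _ _ _ _ _
    · by_cases ha : z = a
      · subst ha
        refine ⟨some true, ?_, by simp [List.idxOf_cons_ne _ hb]⟩
        simpa [scanStep, hz, numItem_inj, hb] using foldl_scanStep_map_some _ _ _ _ _
      · rw [List.idxOf_cons_ne _ ha, List.idxOf_cons_ne _ hb]
        simpa [scanStep, hz, numItem_inj, hb, ha] using ih

theorem foldl_scanStep_listItems (a b n : ℕ) (v : List ℕ) :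
    (listItems v).foldl (scanStep (numItem a) (numItem b)) (none, n) =
      (none, n + if v.idxOf a < v.idxOf b then 1 else 0) := by
  obtain ⟨s, h, hs⟩ := foldl_scanStep_map_none a b n v
  -- An opening bracket is neither a closing one nor a number, so it has no effect.
  have h0 : scanStep (numItem a) (numItem b) (none, n) braItem = (none, n) := by
    simp [scanStep, numItem]
  rw [listItems, List.foldl_cons, h0, List.foldl_append, h]
  by_cases hlt : v.idxOf a < v.idxOf b
  · simp [scanStep, hs.2 hlt, hlt]
  · simp [scanStep, hs, hlt]

theorem foldl_scanStep_flatMap (a b n : ℕ) (V : List (List ℕ)) :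
    (V.flatMap listItems).foldl (scanStep (numItem a) (numItem b)) (none, n) =
      (none, n + V.countP fun v => decide (v.idxOf a < v.idxOf b)) := by
  induction V generalizing n with
  | nil => rfl
  | cons v V ih =>
    rw [List.flatMap_cons, List.foldl_append, foldl_scanStep_listItems, ih, List.countP_cons]
    simp only [decide_eq_true_eq, Prod.mk.injEq, true_and]
    omega

/-- The input of the machine for an instance of the control problem. -/
def _root_.ACDCInstance.input (I : ACDCInstance) : Input where
  votes := I.votes.flatMap listItems
  desp := numItem I.despised
  kac := numItem I.kAC
  kdc := numItem I.kDC
  reg := (I.registered.map numItem).reverse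
  spoil := (I.spoilers.map numItem).reverse

theorem flatMap_str_items (I : ACDCInstance) :
    I.input.items.flatMap Item.str = I.encode := by
  have h : I.input.items = ([I.despised, I.kAC, I.kDC] :: I.registered :: I.spoilers ::
      I.votes).flatMap listItems := by
    simp [Input.items, ACDCInstance.input, listItems]
  rw [h, List.flatMap_assoc]
  exact List.flatMap_congr fun l _ => flatMap_str_listItems l

theorem pref_input (I : ACDCInstance) (a b : ℕ) :
    I.input.pref (numItem a) (numItem b) = I.full.N a b := by
  rw [Input.pref, scanAll, ACDCInstance.input, foldl_scanStep_flatMap, zero_add]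
  rfl

/-- Every vote ends with a closing bracket, which resets the flag before anything is compared; so
`x` and `y` may be arbitrary items, as `Input.Bounded` demands. -/
theorem fst_foldl_scanStep_flatMap (x y : Item) (n : ℕ) (V : List (List ℕ)) :
    ((V.flatMap listItems).foldl (scanStep x y) (none, n)).1 = none := by
  induction V using List.reverseRecOn with
  | nil => rfl
  | append_singleton V v _ =>
    rw [List.flatMap_append, List.flatMap_singleton, listItems, ← List.cons_append,
      ← List.append_assoc, List.foldl_append]
    simp [scanStep]

theorem length_le_length_flatMap_str (l : List Item) : l.length ≤ (l.flatMap Item.str).length := by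
  induction l with
  | nil => simp
  | cons x l ih =>
    simp only [List.flatMap_cons, List.length_append, Item.length_str, List.length_cons]
    omega

theorem length_fst_le_length_flatMap_str {l : List Item} {x : Item} (hx : x ∈ l) :
    x.1.length ≤ (l.flatMap Item.str).length := by
  induction l with
  | nil => simp at hx
  | cons y l ih =>
    simp only [List.flatMap_cons, List.length_append, Item.length_str]
    rcases List.mem_cons.1 hx with rfl | hx
    · omega
    · have := ih hx
      omega

/-- All data occur among the items of the input string, where an item takes one symbol per bit and
one for its mark. -/
theorem bounded_input (I : ACDCInstance) : I.input.Bounded I.encode.length := by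
  have h : ∀ x ∈ I.input.items, x.1.length ≤ I.encode.length := fun x hx => by
    rw [← flatMap_str_items]
    exact length_fst_le_length_flatMap_str hx
  have hl : I.input.items.length ≤ I.encode.length := by
    rw [← flatMap_str_items]
    exact length_le_length_flatMap_str _
  simp only [Input.items, List.length_cons, List.length_append, List.length_reverse] at hl
  constructor
  · exact fun x hx => h x (by simp [Input.items, hx])
  · exact h _ (by simp [Input.items])
  · exact h _ (by simp [Input.items])
  · exact h _ (by simp [Input.items])
  · exact fun x hx => h x (by simp [Input.items, hx])
  · exact fun x hx => h x (by simp [Input.items, hx])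
  · omega
  · omega
  · omega
  · exact fun x y => fst_foldl_scanStep_flatMap x y 0 I.votes

/-- The machine counts list entries, the criterion counts elements of sets; the absence of
repetitions makes these agree. -/
theorem countP_map_numItem {l : List ℕ} (hl : l.Nodup) (p : Item → Bool) :
    (l.map numItem).reverse.countP p = (l.toFinset.filter fun a => p (numItem a) = true).card := by
  rw [List.countP_reverse, List.countP_map, List.countP_eq_length_filter,
    ← List.toFinset_card_of_nodup (hl.filter _), List.toFinset_filter]
  rfl

theorem bad_input (I : ACDCInstance) (c b : ℕ) :
    I.input.bad (numItem c) (numItem b) = false ↔ c ≠ I.despised ∧ b ≠ I.despised ∧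
      (I.A.filter fun a => a = c ∨ a = b).card ≤ I.kAC ∧
      I.full.N I.despised b ≤ I.full.N c I.despised ∧
      (c ≠ b → I.full.N I.despised b ≤ I.full.N c b) ∧
      (I.C.filter fun e => e ≠ c ∧ I.full.N c e < I.full.N I.despised b).card ≤ I.kDC := by
  have hC : I.input.reg.countP (fun e => decide (¬e = numItem c ∧ I.input.pref (numItem c) e <
      I.input.pref I.input.desp (numItem b))) =
      (I.C.filter fun e => e ≠ c ∧ I.full.N c e < I.full.N I.despised b).card := by
    refine (countP_map_numItem I.nodup.of_append_left _).trans (congrArg _ ?_)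
    refine Finset.filter_congr fun e _ => ?_
    have hd : I.input.desp = numItem I.despised := rfl
    rw [decide_eq_true_eq, numItem_inj, hd, pref_input, pref_input]
  have hA : I.input.spoil.countP (fun a => decide (a = numItem c ∨ a = numItem b)) =
      (I.A.filter fun a => a = c ∨ a = b).card := by
    refine (countP_map_numItem I.nodup.of_append_right _).trans (congrArg _ ?_)
    refine Finset.filter_congr fun e _ => ?_
    rw [decide_eq_true_eq, numItem_inj, numItem_inj]
  have hd : I.input.desp = numItem I.despised := rfl
  have hkA : bitsVal I.input.kac.1 = I.kAC := bitsVal_encodeNat _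
  have hkC : bitsVal I.input.kdc.1 = I.kDC := bitsVal_encodeNat _
  unfold Input.bad
  rw [hC, hA, hkA, hkC, hd]
  simp only [pref_input, numItem_inj, Bool.or_eq_false_iff, decide_eq_false_iff_not, not_lt,
    not_and, and_assoc, ne_eq]

/-- By `bad_input`, a pair that is not rejected is a pair as in `isYes_maximin_iff`, and the loops
run over exactly the items of registered candidates and spoilers. -/
theorem any_input (I : ACDCInstance) :
    ((I.input.spoil ++ I.input.reg).any fun c =>
      (I.input.spoil ++ I.input.reg).any fun b => !I.input.bad c b) = true ↔
        I.IsYes maximin := by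
  have hmem : ∀ x, x ∈ I.input.spoil ++ I.input.reg ↔ ∃ a ∈ I.C ∪ I.A, numItem a = x := by
    intro x
    simp only [ACDCInstance.input, List.mem_append, List.mem_reverse, List.mem_map,
      Finset.mem_union, ACDCInstance.C, ACDCInstance.A, List.mem_toFinset]
    constructor
    · rintro (⟨a, ha, rfl⟩ | ⟨a, ha, rfl⟩)
      exacts [⟨a, .inr ha, rfl⟩, ⟨a, .inl ha, rfl⟩]
    · rintro ⟨a, ha | ha, rfl⟩
      exacts [.inr ⟨a, ha, rfl⟩, .inl ⟨a, ha, rfl⟩]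
  rw [I.isYes_maximin_iff]
  simp only [List.any_eq_true, hmem, Bool.not_eq_true']
  constructor
  · rintro ⟨_, ⟨c, hc, rfl⟩, _, ⟨b, hb, rfl⟩, h⟩
    exact ⟨c, hc, b, hb, (bad_input I c b).1 h⟩
  · rintro ⟨c, hc, b, hb, h⟩
    exact ⟨_, ⟨c, hc, rfl⟩, _, ⟨b, hb, rfl⟩, (bad_input I c b).2 h⟩

theorem decidableInPolyTime_isYes_maximin :
    DecidableInPolyTime ACDCInstance.encoding (ACDCInstance.IsYes maximin) := by
  obtain ⟨p, hp⟩ := exists_polynomial_timeSolve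
  refine Cmd.decidableInPolyTime _ _ solve (some .votes) (Mem.empty false).register
    (fun x => x.ans) p fun I => ?_
  have hb := bounded_input I
  have hl : (I.input.spoil ++ I.input.reg).length ≤ I.encode.length := by
    have := length_le_length_flatMap_str I.input.items
    rw [flatMap_str_items] at this
    simp only [Input.items, List.length_cons, List.length_append, List.length_reverse] at this ⊢
    omega
  have h := exec_solve hb (by simp [ACDCInstance.input, numItem])
    (by simp [ACDCInstance.input, numItem]) hl
  refine ⟨(Mem.empty _).register, ?_, any_input I⟩
  have e₀ (ans : Bool) : (Mem.empty ans).stack = fun _ => [] := by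
    funext k
    rcases k with _ | k
    · rfl
    · cases k <;> rfl
  unfold Exec Mem.enc at h
  rw [Mem.register_set, Mem.stack_set, flatMap_str_items, e₀, e₀] at h
  rw [hp]
  exact h

end ACDC

theorem mainTheorem3 : maximin.VulnerableToDestructiveACDC :=
  ⟨susceptible_maximin, ACDC.decidableInPolyTime_isYes_maximin⟩
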